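/- Boolean functions are maps $f\colon\{0,1\}^n\to\{0,1\}$ with $n\ge 1$; $\mathbf 0,\mathbf 1$ are the constant tuples and $\bar{\mathbf a}$ is the complement of $\mathbf a$. For classes $C,K$ of Boolean functions, $CK$ is the class of all compositions $f(g_1,\dots,g_n)$ with $f\in C$ $n$-ary and $g_1,\dots,g_n\in K$ of the same arity. **Classes.** Let $C_0$ be the class of constant $0$ functions, $T_{*1}=\{f: f(\mathbf 1)=1\}$, $T_{1*}=\{f: f(\mathbf 0)=1\}$, $T_{01}=\{f: f(\mathbf 0)=0,\ f(\mathbf 1)=1\}$, $T_{10}=\{f: f(\mathbf 0)=1,\ f(\mathbf 1)=0\}$; $M$ the monotone functions, $M_0=\{f\in M: f(\mathbf 0)=0\}$, $M_1=\{f\in M: f(\mathbf 1)=1\}$, $M_{01}=M_0\cap M_1$; $\overline{C}=\{\neg f: f\in C\}$ (so $\overline{M_1}$ consists of the antitone $f$ with $f(\mathbf 1)=0$); $R=\{f: f(\mathbf a)=f(\bar{\mathbf a})\text{ for all }\mathbf a\}$ and $R_{00}=\{f\in R: f(\mathbf 0)=f(\mathbf 1)=0\}$. Let $I_c$ be the set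 of projections. For $k\ge 2$ let $MU^k_{01}$ be the set of $f\in M_{01}$ such that $\bigwedge T\ne\mathbf 0$ for every set $T$ of at most $k$ true points of $f$ (true points are the elements of $f^{-1}(1)$). An $(I_c,MU^k_{01})$-clonoid is a class $K$ with $K I_c\subseteq K$ and $MU^k_{01}K\subseteq K$; these form a lattice under inclusion. **Ideals.** A function $f$ is a minorant of $g$ if they have the same arity and $f\le g$ pointwise; an $n$-ary $f$ is a minor of an $m$-ary $g$ if $f(\mathbf a)=g(\mathbf a\circ\sigma)$ for all $\mathbf a$, for some $\sigma\colon\{1,\dots,m\}\to\{1,\dots,n\}$. Let $\preceq$ be the transitive closure of the union of the minorant and minor relations. For $C\in\{T_{*1},T_{1*},M,\overline M,R\}$ the $C$-closure $g^C$ is the least majorant of $g$ (of the same arity) in $C$, and $\preceq_C$ is the transitive closure of the union of the minorant relation, the minor relation and $\{(g^C,g)\}$. Let $\Omega^{[\le k]}$ be the set of Boolean functions with at most $k$ true points, and let $\mathcal I_k$ (resp. $\mathcal I_k(C)$) be the lattice, under inclusion, of all subsets (including $\emptyset$) of $\Omega^{[\le k]}$ that are downward closed in $\Omega^{[\le k]}$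 for $\preceq$ (resp. $\preceq_C$). For a set $\Theta$ of Boolean functions let $U^k(\Theta)$ be the class of all $f$, say of arity $n$, such that for every set $T$ of at most $k$ true points of $f$ there are $\theta\in\Theta$, of arity $h$ say, and $\tau\colon\{1,\dots,h\}\to\{1,\dots,n\}$ with $\theta(\mathbf a\circ\tau)=1$ for all $\mathbf a\in T$. **Theorem.** Let $k\ge 2$ be an integer and let $\Theta\in\mathcal I_k$ with $\Theta\notin\{\Omega^{[\le k]},C_0,\emptyset\}$. All classes whose lower covers are described below are $(I_c,MU^k_{01})$-clonoids, and "lower cover" of a class means lower cover in the lattice of $(I_c,MU^k_{01})$-clonoids. (i) The lower covers of $U^k(\Theta)$ are exactly the classes $U^k(\Psi)$ for the lower covers $\Psi$ of $\Theta$ in $\mathcal I_k$ and, additionally: $U^k(\Theta)\cap(T_{01}\cup C_0)$ if $\Theta\in\mathcal I_k(T_{*1})$; $U^k(\Theta)\cap(T_{10}\cup C_0)$ if $\Theta\in\mathcal I_k(T_{1*})$; $U^k(\Theta)\cap R_{00}$ if $\Theta\in\mathcal I_k(R)$. (ii) Let $\Theta\in\mathcal I_k(T_{*1})$. (a) The lower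 covers of $U^k(\Theta)\cap(T_{01}\cup C_0)$ are exactly the classes $U^k(\Psi)\cap(T_{01}\cup C_0)$ for the nonempty lower covers $\Psi$ of $\Theta$ in $\mathcal I_k(T_{*1})$, the class $U^k(\Theta)\cap T_{01}$ and, if $\Theta\in\mathcal I_k(M)$, the class $U^k(\Theta)\cap M_0$. (b) The lower covers of $U^k(\Theta)\cap T_{01}$ are exactly the classes $U^k(\Psi)\cap T_{01}$ for the nonempty lower covers $\Psi$ of $\Theta$ in $\mathcal I_k(T_{*1})$ and, if $\Theta\in\mathcal I_k(M)$, the class $U^k(\Theta)\cap M_{01}$. (iii) Let $\Theta\in\mathcal I_k(T_{1*})$. (a) The lower covers of $U^k(\Theta)\cap(T_{10}\cup C_0)$ are exactly the classes $U^k(\Psi)\cap(T_{10}\cup C_0)$ for the nonempty lower covers $\Psi$ of $\Theta$ in $\mathcal I_k(T_{1*})$, the class $U^k(\Theta)\cap T_{10}$ and, if $\Theta\in\mathcal I_k(\overline M)$, the class $U^k(\Theta)\cap\overline{M_1}$. (b) The lower covers of $U^k(\Theta)\cap T_{10}$ are exactly the classes $U^k(\Psi)\cap T_{10}$ for the nonempty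 lower covers $\Psi$ of $\Theta$ in $\mathcal I_k(T_{1*})$ and, if $\Theta\in\mathcal I_k(\overline M)$, the class $U^k(\Theta)\cap\overline{M_{01}}$. (iv) Let $\Theta\in\mathcal I_k(M)$. (a) The lower covers of $U^k(\Theta)\cap M_0$ are exactly the classes $U^k(\Psi)\cap M_0$ for the lower covers $\Psi$ of $\Theta$ in $\mathcal I_k(M)$, and $U^k(\Theta)\cap M_{01}$. (b) The lower covers of $U^k(\Theta)\cap M_{01}$ are exactly the classes $U^k(\Psi)\cap M_{01}$ for the lower covers $\Psi$ of $\Theta$ in $\mathcal I_k(M)$. (v) Let $\Theta\in\mathcal I_k(\overline M)$. (a) The lower covers of $U^k(\Theta)\cap\overline{M_1}$ are exactly the classes $U^k(\Psi)\cap\overline{M_1}$ for the lower covers $\Psi$ of $\Theta$ in $\mathcal I_k(\overline M)$, and $U^k(\Theta)\cap\overline{M_{01}}$. (b) The lower covers of $U^k(\Theta)\cap\overline{M_{01}}$ are exactly the classes $U^k(\Psi)\cap\overline{M_{01}}$ for the lower covers $\Psi$ of $\Theta$ in $\mathcal I_k(\overline M)$. (vi) Let $\Theta\in\mathcal I_k(R)$.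 The lower covers of $U^k(\Theta)\cap R_{00}$ are exactly the classes $U^k(\Psi)\cap R_{00}$ for the lower covers $\Psi$ of $\Theta$ in $\mathcal I_k(R)$. -/

import Mathlib

namespace BoolClonoid

/-! ### Boolean functions, composition, clonoids -/

/-- Boolean functions of several arguments, of arbitrary positive arity. -/
abbrev BoolFun : Type := Σ n : ℕ+, ((Fin n → Bool) → Bool)

/-- The composition `C K` of classes: all `f(g₁, …, gₙ)` with `f ∈ C` of arity `n` and
`g₁, …, gₙ ∈ K` of a common arity `m`. -/
def classComp (C K : Set BoolFun) : Set BoolFun :=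
  {h | ∃ (n m : ℕ+) (f : (Fin n → Bool) → Bool) (g : Fin n → (Fin m → Bool) → Bool),
    (⟨n, f⟩ : BoolFun) ∈ C ∧ (∀ i, (⟨m, g i⟩ : BoolFun) ∈ K) ∧
      h = ⟨m, fun a => f (fun i => g i a)⟩}

/-- The set of all `(C₁, C₂)`-clonoids: the classes stable under right composition with `C₁`
and under left composition with `C₂`. -/
def clonoids (C₁ C₂ : Set BoolFun) : Set (Set BoolFun) :=
  {K | classComp K C₁ ⊆ K ∧ classComp C₂ K ⊆ K}

/-- `L` is a lower cover of `K` in the family `𝓛` of sets, ordered by inclusion. -/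
def IsLowerCover {α : Type*} (𝓛 : Set (Set α)) (L K : Set α) : Prop :=
  ∃ (hL : L ∈ 𝓛) (hK : K ∈ 𝓛), (⟨L, hL⟩ : 𝓛) ⋖ ⟨K, hK⟩

/-- `K` belongs to the family `𝓛`, and its lower covers in `𝓛` are exactly the members of `S`. -/
def HasLowerCovers {α : Type*} (𝓛 : Set (Set α)) (K : Set α) (S : Set (Set α)) : Prop :=
  K ∈ 𝓛 ∧ ∀ L, IsLowerCover 𝓛 L K ↔ L ∈ S

/-! ### Classes of Boolean functions -/

/-- The members `f` of `C` with `f(0, …, 0) = a`. -/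
def valZero (C : Set BoolFun) (a : Bool) : Set BoolFun := {f ∈ C | f.2 (fun _ => false) = a}

/-- The members `f` of `C` with `f(1, …, 1) = b`. -/
def valOne (C : Set BoolFun) (b : Bool) : Set BoolFun := {f ∈ C | f.2 (fun _ => true) = b}

/-- The members `f` of `C` with `f(0, …, 0) = a` and `f(1, …, 1) = b`. -/
def val (C : Set BoolFun) (a b : Bool) : Set BoolFun := valZero C a ∩ valOne C b

/-- `T_{*1}`: the functions with `f(1, …, 1) = 1`. -/
def clXI : Set BoolFun := valOne Set.univ true

/-- `T_{1*}`: the functions with `f(0, …, 0) = 1`. -/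
def clIX : Set BoolFun := valZero Set.univ true

/-- `T_{01}`. -/
def clOI : Set BoolFun := val Set.univ false true

/-- `T_{10}`. -/
def clIO : Set BoolFun := val Set.univ true false

/-- `C₀`: the constant zero functions. -/
def constZero : Set BoolFun := {f | ∀ a, f.2 a = false}

/-- `M`: the monotone functions. -/
def clM : Set BoolFun := {f | ∀ a b, a ≤ b → f.2 a ≤ f.2 b}

/-- `M₀`. -/
def clM0 : Set BoolFun := valZero clM false

/-- `M₁`. -/
def clM1 : Set BoolFun := valOne clM true

/-- `M₀₁`. -/
def clM01 : Set BoolFun := val clM false true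

/-- The class of the (outer) negations of the members of `C`. -/
def negClass (C : Set BoolFun) : Set BoolFun :=
  {f | ∃ g ∈ C, f = ⟨g.1, fun a => !(g.2 a)⟩}

/-- `R`: the reflexive functions, those with `f(a) = f(ā)`, where `ā` is the complement of `a`. -/
def clR : Set BoolFun := {f | ∀ a, f.2 a = f.2 (fun i => !(a i))}

/-- `R₀₀`. -/
def clR00 : Set BoolFun := val clR false false

/-- `U^k`: the `1`-separating functions of rank `k`. -/
def clU (k : ℕ) : Set BoolFun :=
  {f | ∀ T : Finset (Fin f.1 → Bool), T.card ≤ k → (∀ a ∈ T, f.2 a = true) →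
    T.inf id ≠ (fun _ => false)}

/-- `MU^k_{01}`. -/
def clMU01 (k : ℕ) : Set BoolFun := clM01 ∩ clU k

/-- `I_c`: the projections. -/
def clProj : Set BoolFun := {f | ∃ i, f.2 = fun a => a i}

/-! ### The minorant-minor order and its extensions -/

/-- `f` is a minorant of `g`: they have the same arity and `f ≤ g` pointwise. -/
inductive Minorant : BoolFun → BoolFun → Prop
  | intro {n : ℕ+} {f g : (Fin n → Bool) → Bool} (h : ∀ a, f a ≤ g a) : Minorant ⟨n, f⟩ ⟨n, g⟩

/-- `f` is a minor of `g`. -/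
def Minor (f g : BoolFun) : Prop := ∃ σ : Fin g.1 → Fin f.1, f.2 = fun a => g.2 (a ∘ σ)

/-- `f` is the `C`-closure of `g`: the least majorant of `g` that belongs to `C`. -/
inductive IsClosureOf (C : Set BoolFun) : BoolFun → BoolFun → Prop
  | intro {n : ℕ+} {f g : (Fin n → Bool) → Bool}
      (h : IsLeast {u : (Fin n → Bool) → Bool | (∀ a, g a ≤ u a) ∧ (⟨n, u⟩ : BoolFun) ∈ C} f) :
      IsClosureOf C ⟨n, f⟩ ⟨n, g⟩

/-- The minorant-minor quasiorder. -/
def MinMin : BoolFun → BoolFun → Prop :=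
  Relation.TransGen fun f g => Minorant f g ∨ Minor f g

/-- The `C`-closed minorant-minor quasiorder. -/
def MinMinC (C : Set BoolFun) : BoolFun → BoolFun → Prop :=
  Relation.TransGen fun f g => Minorant f g ∨ Minor f g ∨ IsClosureOf C f g

/-- The Boolean functions with at most `k` true points. -/
def atMost (k : ℕ) : Set BoolFun :=
  {f | (Finset.univ.filter fun a => f.2 a = true).card ≤ k}

/-- The order ideals (downsets, the empty one included) of `atMost k` with respect to the
restriction of a quasiorder `r`; an ideal of the poset of equivalence classes is identified with
the union of its members. -/
def ideals (r : BoolFun → BoolFun → Prop) (k : ℕ) : Set (Set BoolFun) :=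
  {Θ | Θ ⊆ atMost k ∧ ∀ φ ∈ Θ, ∀ γ ∈ atMost k, r γ φ → γ ∈ Θ}

/-- `U^k(Θ)`: the functions `f` such that for every set `T` of at most `k` true points of `f`
there is a minor `θ_τ` of some `θ ∈ Θ` that takes value `1` on all of `T`. -/
def clUT (k : ℕ) (Θ : Set BoolFun) : Set BoolFun :=
  {f | ∀ T : Finset (Fin f.1 → Bool), T.card ≤ k → (∀ a ∈ T, f.2 a = true) →
    ∃ θ ∈ Θ, ∃ τ : Fin θ.1 → Fin f.1, ∀ a ∈ T, θ.2 (a ∘ τ) = true}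

end BoolClonoid

open BoolClonoid

/-!
Fix `k ≥ 2`. The proof attaches to a clonoid `K` its *shadow*, the ideal of all functions with at
most `k` true points that lie below some member of `K`. Always `K ⊆ U^k(shadow K)`, and the shadow
of `U^k(Θ)` is `Θ`.

The missing part of the information about `K` is binary. By the interpolation lemma
`mem_of_interpolation`, a function `h` in `U^k(shadow K)` belongs to `K` as soon as members of `K`
separate each true point of `h` from each false point of `h` and take the value `0` at each false
point: the least monotone function that preserves `1` and is `1` at the rows of values belonging
to the true points of `h` lies in `MU^k_{01}`, and it expresses `h` through all the members of `K`
of the same arity. Whether a pair `(a, b)` is separated only depends on the set of columns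
`(aᵢ, bᵢ)` that occur, because `K` is closed under minors. So only a few clonoids share
a shadow `Θ` that does not contain the constant `1`:
* if `K` contains the identity, `K` contains `U^k(Θ)`, or lies in `T₀₁ ∪ C₀`; in the latter case
  it contains `U^k(Θ) ∩ T₀₁` unless all its members are monotone, and it always contains
  `U^k(Θ) ∩ M₀₁` (`clUT_shadow_subset_of_idFun`, `clUT_shadow_inter_clOI_subset`,
  `clUT_shadow_inter_clM01_subset`); what remains open is whether the constants `0` are in `K`;
* if `K` contains the negation, the inner negation `a ↦ f(ā)` leads back to the first case;
* otherwise all members of `K` vanish at both constant tuples, and `K` contains `U^k(Θ)`, or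
  consists of reflexive functions and contains `U^k(Θ) ∩ R`
  (`clUT_shadow_subset_of_not_subset_clR`, `clUT_shadow_inter_clR_subset`).

If `Θ` is closed under the closures that belong to `X`, then, degenerate cases aside, the class
`U^k(Θ) ∩ X` has shadow `Θ`. Consequently a lower cover of such a class either has the same
shadow, and is found in the list above, or comes from a lower cover of the ideal `Θ`. This
argument is the same for all the classes, and is isolated in `hasLowerCovers_of_embedding`. The
statements about `T₁₀` and antitone functions follow from those about `T₀₁` and monotone functions
by inner negation.
-/

namespace BoolClonoid

variable {k : ℕ} {K L Θ Ψ C X : Set BoolFun}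

/-! ### Clonoids and interpolation -/

theorem minor_mem (hK : classComp K clProj ⊆ K) {n m : ℕ+} {f : (Fin n → Bool) → Bool}
    (hf : (⟨n, f⟩ : BoolFun) ∈ K) (σ : Fin n → Fin m) :
    (⟨m, fun a => f (a ∘ σ)⟩ : BoolFun) ∈ K :=
  hK ⟨n, m, f, fun i a => a (σ i), hf, fun i => ⟨σ i, rfl⟩, rfl⟩

theorem bool_le_iff {a b : Bool} : a ≤ b ↔ (a = true → b = true) := by
  cases a <;> cases b <;> decide

theorem point_eq_zero {n : ℕ+} {a : Fin n → Bool} (h : ∀ i, ¬ a i = true) :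
    a = fun _ => false := by
  funext i; simpa using h i

theorem point_eq_one {n : ℕ+} {a : Fin n → Bool} (h : ∀ i, a i = true) :
    a = fun _ => true := funext h

theorem exists_common_one {n : ℕ+} {T : Finset (Fin n → Bool)}
    (h : T.inf id ≠ fun _ => false) : ∃ i, ∀ a ∈ T, a i = true := by
  obtain ⟨i, hi⟩ : ∃ i, T.inf id i = true := by
    by_contra hc
    push Not at hc
    exact h (point_eq_zero hc)
  refine ⟨i, fun a ha => ?_⟩
  have := (Finset.inf_le (f := id) ha : T.inf id ≤ a) i
  exact bool_le_iff.1 this hi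

theorem inf_ne_zero {n : ℕ+} {T : Finset (Fin n → Bool)} {i : Fin n}
    (h : ∀ a ∈ T, a i = true) : T.inf id ≠ fun _ => false := by
  intro hc
  have h1 : (fun j => decide (j = i)) ≤ T.inf id := by
    refine Finset.le_inf fun a ha j => bool_le_iff.2 fun hj => ?_
    rw [of_decide_eq_true hj]
    exact h a ha
  have := bool_le_iff.1 (h1 i)
  rw [hc] at this
  simp at this

/-- The class of the functions with at most `k` true points that lie below some member of `K`. -/
def shadow (k : ℕ) (K : Set BoolFun) : Set BoolFun :=
  {f ∈ atMost k | ∃ g, (⟨f.1, g⟩ : BoolFun) ∈ K ∧ ∀ a, f.2 a = true → g a = true}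

theorem shadow_mono (h : K ⊆ L) : shadow k K ⊆ shadow k L :=
  fun _ ⟨h1, g, h2, h3⟩ => ⟨h1, g, h h2, h3⟩

theorem clUT_mono (h : Θ ⊆ Ψ) : clUT k Θ ⊆ clUT k Ψ := fun _ hf T hT hT' =>
  let ⟨θ, hθ, τ, h'⟩ := hf T hT hT'
  ⟨θ, h hθ, τ, h'⟩

/-- In a clonoid `K`, membership in `U^k` of the shadow means that any `k` true points of `h`
are simultaneously true points of some member of `K`. -/
theorem exists_mem_of_mem_clUT_shadow (hK : classComp K clProj ⊆ K) {n : ℕ+}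
    {h : (Fin n → Bool) → Bool} (hh : (⟨n, h⟩ : BoolFun) ∈ clUT k (shadow k K))
    (T : Finset (Fin n → Bool)) (hT : T.card ≤ k) (hT' : ∀ a ∈ T, h a = true) :
    ∃ g, (⟨n, g⟩ : BoolFun) ∈ K ∧ ∀ a ∈ T, g a = true := by
  obtain ⟨⟨m, θ⟩, ⟨-, g, hg, hθg⟩, τ, hτ⟩ := hh T hT hT'
  exact ⟨_, minor_mem hK hg τ, fun a ha => hθg _ (hτ a ha)⟩

/-- Interpolation: a function belongs to a nonempty clonoid with target `MU^k_{01}` as soon as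
it satisfies the conditions imposed by the members of the clonoid on any `k` true points, on any
pair of a true and a false point, and on any false point. -/
theorem mem_of_interpolation {n : ℕ+} {h : (Fin n → Bool) → Bool}
    (hk : 1 ≤ k) (hK : K ∈ clonoids clProj (clMU01 k))
    (h1 : (⟨n, h⟩ : BoolFun) ∈ clUT k (shadow k K))
    (h2 : ∀ a b, h a = true → h b = false →
      ∃ g, (⟨n, g⟩ : BoolFun) ∈ K ∧ g a = true ∧ g b = false)
    (h3 : ∀ b, h b = false → ∃ g, (⟨n, g⟩ : BoolFun) ∈ K ∧ g b = false) :
    (⟨n, h⟩ : BoolFun) ∈ K := by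
  classical
  have hT := exists_mem_of_mem_clUT_shadow hK.1 h1
  let S := {g : (Fin n → Bool) → Bool // (⟨n, g⟩ : BoolFun) ∈ K}
  have hS : Nonempty S := by
    obtain ⟨g, hg, -⟩ := hT ∅ (by simp) (by simp)
    exact ⟨g, hg⟩
  let m : ℕ+ := ⟨Fintype.card S, Fintype.card_pos⟩
  let e : S ≃ Fin m := Fintype.equivFin S
  let row : (Fin n → Bool) → (Fin m → Bool) := fun a i => (e.symm i).1 a
  -- the least monotone function that is `1` at `1` and at the rows of the true points of `h`
  let F : (Fin m → Bool) → Bool := fun x =>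
    decide ((∀ i, x i = true) ∨ ∃ a, h a = true ∧ row a ≤ x)
  have hF : ∀ x, F x = true ↔ (∀ i, x i = true) ∨ ∃ a, h a = true ∧ row a ≤ x :=
    fun x => decide_eq_true_iff
  have hmono : (⟨m, F⟩ : BoolFun) ∈ clM := by
    intro x y hxy
    refine bool_le_iff.2 fun hx => (hF y).2 ?_
    rcases (hF x).1 hx with hx | ⟨a, ha, hax⟩
    · exact Or.inl fun i => bool_le_iff.1 (hxy i) (hx i)
    · exact Or.inr ⟨a, ha, hax.trans hxy⟩
  have hsep : (⟨m, F⟩ : BoolFun) ∈ clU k := by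
    intro T hTk hTt
    -- each true point of `F` other than `1` lies above the row of a true point of `h`
    have hc : ∀ x : Fin m → Bool, F x = true → ¬ (∀ i, x i = true) →
        ∃ a, h a = true ∧ row a ≤ x := fun x hx h' => ((hF x).1 hx).resolve_left h'
    choose! c hc1 hc2 using hc
    let T' := (T.filter fun x => ¬ ∀ i, x i = true).image c
    obtain ⟨g, hg, hgT⟩ := hT T'
      (Finset.card_image_le.trans ((Finset.card_filter_le _ _).trans hTk)) (by
        intro a ha
        simp only [T', Finset.mem_image, Finset.mem_filter] at ha
        obtain ⟨x, ⟨hxT, hx⟩, rfl⟩ := ha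
        exact hc1 x (hTt x hxT) hx)
    refine inf_ne_zero (i := e ⟨g, hg⟩) fun x hx => ?_
    by_cases hx1 : ∀ i, x i = true
    · exact hx1 _
    · refine bool_le_iff.1 (hc2 x (hTt x hx) hx1 (e ⟨g, hg⟩)) ?_
      have : g (c x) = true := hgT _ (Finset.mem_image_of_mem _ (Finset.mem_filter.2 ⟨hx, hx1⟩))
      simpa [row] using this
  have hzero : F (fun _ => false) = false := by
    rw [Bool.eq_false_iff, Ne, hF]
    rintro (h0 | ⟨a, ha, ha0⟩)
    · exact absurd (h0 (e hS.some)) (by simp)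
    · obtain ⟨g, hg, hga⟩ := hT {a} (by simpa using hk) (by simpa using ha)
      have := bool_le_iff.1 (ha0 (e ⟨g, hg⟩))
      simp [row, hga a (by simp)] at this
  have hone : F (fun _ => true) = true := (hF _).2 (Or.inl fun _ => rfl)
  refine hK.2 ⟨m, n, F, fun i => (e.symm i).1,
    ⟨⟨⟨hmono, hzero⟩, ⟨hmono, hone⟩⟩, hsep⟩, fun i => (e.symm i).2, ?_⟩
  congr 1
  funext b
  change h b = F (row b)
  cases hb : h b with
  | true => exact ((hF _).2 (Or.inr ⟨b, hb, le_rfl⟩)).symm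
  | false =>
    symm
    rw [Bool.eq_false_iff, Ne, hF]
    rintro (hb1 | ⟨a, ha, hab⟩)
    · obtain ⟨g, hg, hgb⟩ := h3 b hb
      have := hb1 (e ⟨g, hg⟩)
      simp [row, hgb] at this
    · obtain ⟨g, hg, hga, hgb⟩ := h2 a b ha hb
      have := bool_le_iff.1 (hab (e ⟨g, hg⟩))
      simp [row, hga, hgb] at this

/-! ### Clonoids among the classes of the theorem -/

theorem inter_mem_clonoids {D E : Set BoolFun} (hK : K ∈ clonoids D E)
    (hL : L ∈ clonoids D E) : K ∩ L ∈ clonoids D E := by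
  refine ⟨?_, ?_⟩
  · rintro _ ⟨n, m, f, g, hf, hg, rfl⟩
    exact ⟨hK.1 ⟨n, m, f, g, hf.1, hg, rfl⟩, hL.1 ⟨n, m, f, g, hf.2, hg, rfl⟩⟩
  · rintro _ ⟨n, m, f, g, hf, hg, rfl⟩
    exact ⟨hK.2 ⟨n, m, f, g, hf, fun i => (hg i).1, rfl⟩,
      hL.2 ⟨n, m, f, g, hf, fun i => (hg i).2, rfl⟩⟩

/-- A class is an `(I_c, MU^k_{01})`-clonoid if it is closed under minors and under left
composition with the monotone functions preserving both constants that are `1`-separating. -/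
theorem mem_clonoids_of
    (h1 : ∀ {n m : ℕ+} {f : (Fin n → Bool) → Bool} (σ : Fin n → Fin m),
      (⟨n, f⟩ : BoolFun) ∈ K → (⟨m, fun a => f (a ∘ σ)⟩ : BoolFun) ∈ K)
    (h2 : ∀ {n m : ℕ+} {f : (Fin n → Bool) → Bool} {g : Fin n → (Fin m → Bool) → Bool},
      (∀ a b, a ≤ b → f a = true → f b = true) → f (fun _ => false) = false →
      f (fun _ => true) = true → (⟨n, f⟩ : BoolFun) ∈ clU k →
      (∀ i, (⟨m, g i⟩ : BoolFun) ∈ K) → (⟨m, fun a => f fun i => g i a⟩ : BoolFun) ∈ K) :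
    K ∈ clonoids clProj (clMU01 k) := by
  refine ⟨?_, ?_⟩
  · rintro _ ⟨n, m, f, g, hf, hg, rfl⟩
    choose σ hσ using hg
    have e : g = fun i a => a (σ i) := funext hσ
    rw [e]
    exact h1 σ hf
  · rintro _ ⟨n, m, f, g, ⟨⟨⟨hm, h0⟩, -, h1'⟩, hU⟩, hg, rfl⟩
    exact h2 (fun a b hab => bool_le_iff.1 (hm a b hab)) h0 h1' hU hg

theorem clUT_mem_clonoids : clUT k Θ ∈ clonoids clProj (clMU01 k) := by
  classical
  refine mem_clonoids_of ?_ ?_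
  · intro n m f σ hf T hT hT'
    obtain ⟨θ, hθ, τ, h⟩ := hf (T.image (· ∘ σ)) (Finset.card_image_le.trans hT) (by
      intro a ha
      obtain ⟨b, hb, rfl⟩ := Finset.mem_image.1 ha
      exact hT' b hb)
    exact ⟨θ, hθ, σ ∘ τ, fun a ha => h _ (Finset.mem_image_of_mem _ ha)⟩
  · intro n m f g _ _ _ hU hg T hT hT'
    obtain ⟨i, hi⟩ := exists_common_one (hU (T.image fun a i => g i a)
      (Finset.card_image_le.trans hT) (by
        intro a ha
        obtain ⟨b, hb, rfl⟩ := Finset.mem_image.1 ha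
        exact hT' b hb))
    exact hg i T hT fun a ha => hi _ (Finset.mem_image_of_mem _ ha)

theorem mem_clOI {n : ℕ+} {f : (Fin n → Bool) → Bool} : (⟨n, f⟩ : BoolFun) ∈ clOI ↔
    f (fun _ => false) = false ∧ f (fun _ => true) = true := by
  simp [clOI, val, valZero, valOne]

theorem mem_clM {n : ℕ+} {f : (Fin n → Bool) → Bool} : (⟨n, f⟩ : BoolFun) ∈ clM ↔
    ∀ a b, a ≤ b → f a = true → f b = true := by
  simp [clM, bool_le_iff]

theorem clM01_eq : clM01 = clM ∩ clOI := by
  ext f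
  simp [clM01, clOI, val, valZero, valOne]
  tauto

theorem clR00_eq : clR00 = clR ∩ val Set.univ false false := by
  ext f
  simp [clR00, val, valZero, valOne]
  tauto

theorem clOI_mem_clonoids : clOI ∈ clonoids clProj (clMU01 k) := by
  refine mem_clonoids_of ?_ ?_
  · intro n m f σ hf
    exact hf
  · intro n m f g _ h0 h1 _ hg
    simp only [mem_clOI] at hg ⊢
    simp [hg, h0, h1]

theorem clOI_union_constZero_mem_clonoids :
    clOI ∪ constZero ∈ clonoids clProj (clMU01 k) := by
  refine mem_clonoids_of ?_ ?_
  · rintro n m f σ (hf | hf)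
    · exact Or.inl hf
    · exact Or.inr fun a => hf _
  · intro n m f g hm h0 _ _ hg
    have hg0 : ∀ i, g i (fun _ => false) = false := fun i =>
      (hg i).elim (fun h => (mem_clOI.1 h).1) fun h => h _
    have hg1 : ∀ i a, g i a = true → g i (fun _ => true) = true := fun i a h =>
      (hg i).elim (fun h => (mem_clOI.1 h).2) fun h' => absurd (h.symm.trans (h' a)) (by simp)
    by_cases h : f (fun i => g i fun _ => true) = true
    · exact Or.inl (mem_clOI.2 ⟨by simp [hg0, h0], h⟩)
    · refine Or.inr fun a => ?_
      rw [Bool.eq_false_iff]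
      exact fun ha => h (hm _ _ (fun i => bool_le_iff.2 (hg1 i a)) ha)

theorem clM_mem_clonoids : clM ∈ clonoids clProj (clMU01 k) := by
  refine mem_clonoids_of ?_ ?_
  · intro n m f σ hf a b hab
    exact hf _ _ fun i => hab _
  · intro n m f g hm _ _ _ hg a b hab
    exact bool_le_iff.2 (hm _ _ fun i => hg i a b hab)

theorem clM0_mem_clonoids : clM0 ∈ clonoids clProj (clMU01 k) := by
  refine mem_clonoids_of ?_ ?_
  · intro n m f σ hf
    exact ⟨fun a b hab => hf.1 _ _ fun i => hab _, hf.2⟩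
  · intro n m f g hm h0 _ _ hg
    refine ⟨fun a b hab => bool_le_iff.2 (hm _ _ fun i => (hg i).1 a b hab), ?_⟩
    have : ∀ i, g i (fun _ => false) = false := fun i => (hg i).2
    simp [this, h0]

theorem clM01_mem_clonoids : clM01 ∈ clonoids clProj (clMU01 k) :=
  clM01_eq ▸ inter_mem_clonoids clM_mem_clonoids clOI_mem_clonoids

theorem clR00_mem_clonoids : clR00 ∈ clonoids clProj (clMU01 k) := by
  refine mem_clonoids_of ?_ ?_
  · intro n m f σ hf
    exact ⟨⟨fun a => hf.1.1 _, hf.1.2⟩, ⟨fun a => hf.1.1 _, hf.2.2⟩⟩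
  · intro n m f g hm h0 _ _ hg
    have hR : ∀ i a, g i a = g i fun j => !(a j) := fun i => (hg i).1.1
    have hR' : (⟨m, fun a => f fun i => g i a⟩ : BoolFun) ∈ clR := fun a =>
      congrArg f (funext fun i => hR i a)
    have e0 : ∀ i, g i (fun _ => false) = false := fun i => (hg i).1.2
    have e1 : ∀ i, g i (fun _ => true) = false := fun i => (hg i).2.2
    exact ⟨⟨hR', by simp [e0, h0]⟩, ⟨hR', by simp [e1, h0]⟩⟩

/-! ### Ideals, shadows and closures -/

/-- The identity function of one variable. -/
def idFun : BoolFun := ⟨1, fun a => a 0⟩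

/-- The constant `1` function of one variable. -/
def oneFun : BoolFun := ⟨1, fun _ => true⟩

/-- The conjunction `¬ x ∧ y`. -/
def ltFun : BoolFun := ⟨2, fun a => !(a 0) && a 1⟩

theorem atMost_of_subset {n : ℕ+} {f : (Fin n → Bool) → Bool} {T : Finset (Fin n → Bool)}
    (hT : T.card ≤ k) (h : ∀ a, f a = true → a ∈ T) : (⟨n, f⟩ : BoolFun) ∈ atMost k :=
  (Finset.card_le_card fun a ha => h a (Finset.mem_filter.1 ha).2).trans hT

theorem exists_finset_of_atMost {n : ℕ+} {f : (Fin n → Bool) → Bool}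
    (h : (⟨n, f⟩ : BoolFun) ∈ atMost k) :
    ∃ T : Finset (Fin n → Bool), T.card ≤ k ∧ ∀ a, a ∈ T ↔ f a = true :=
  ⟨_, h, fun a => by simp⟩

/-- `Fin (1 : ℕ+)` is `Fin 1` only after unfolding, which hides its `Subsingleton` instance. -/
theorem fin_one_eq_zero (i : Fin (1 : ℕ+)) : i = 0 := @Subsingleton.elim (Fin 1) _ i 0

theorem idFun_mem_atMost (hk : 2 ≤ k) : idFun ∈ atMost k :=
  atMost_of_subset (T := {fun _ => true})
    ((Finset.card_singleton _).trans_le (by lia)) fun a ha => by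
    rw [Finset.mem_singleton]
    funext i
    rw [fin_one_eq_zero i]
    exact ha

theorem oneFun_mem_atMost (hk : 2 ≤ k) : oneFun ∈ atMost k :=
  atMost_of_subset (T := {fun _ => true, fun _ => false}) (Finset.card_le_two.trans hk)
    fun a _ => by
      have h : ∀ b, a 0 = b → a = fun _ => b := fun b hb => by
        funext i
        rw [fin_one_eq_zero i, hb]
      rw [Finset.mem_insert, Finset.mem_singleton]
      cases ha : a 0 with
      | false => exact Or.inr (h _ ha)
      | true => exact Or.inl (h _ ha)

theorem constZero_subset_atMost : constZero ⊆ atMost k := fun f hf =>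
  atMost_of_subset (T := ∅) (by simp) fun a ha => by simp [hf a] at ha

theorem transGen_ideals_mono {r s : BoolFun → BoolFun → Prop} (h : ∀ f g, r f g → s f g) :
    ideals (Relation.TransGen s) k ⊆ ideals (Relation.TransGen r) k := fun _ hΘ =>
  ⟨hΘ.1, fun φ hφ γ hγ hr => hΘ.2 φ hφ γ hγ (Relation.TransGen.mono h _ _ hr)⟩

theorem ideals_minMinC_subset : ideals (MinMinC C) k ⊆ ideals MinMin k :=
  transGen_ideals_mono fun _ _ h => h.elim Or.inl (Or.inr ∘ Or.inl)

/-- The members with at most `k` true points of a class closed under `r` form an ideal. -/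
theorem inter_atMost_mem_ideals {r : BoolFun → BoolFun → Prop} {D : Set BoolFun}
    (h : ∀ f g, r f g → g ∈ D → f ∈ D) : atMost k ∩ D ∈ ideals (Relation.TransGen r) k := by
  refine ⟨Set.inter_subset_left, fun φ hφ γ hγ hr => ⟨hγ, ?_⟩⟩
  have := hφ.2
  clear hγ hφ
  induction hr using Relation.TransGen.head_induction_on with
  | single h' => exact h _ _ h' this
  | head h' _ ih => exact h _ _ h' ih

/-- An ideal for the minorant-minor order contains each function with at most `k` true points
that lies below a minor of a member. -/
theorem mem_of_le_minor (hΘ : Θ ∈ ideals MinMin k) {n m : ℕ+} {θ : (Fin m → Bool) → Bool}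
    {f : (Fin n → Bool) → Bool} (hθ : (⟨m, θ⟩ : BoolFun) ∈ Θ) (σ : Fin m → Fin n)
    (hf : (⟨n, f⟩ : BoolFun) ∈ atMost k) (h : ∀ a, f a = true → θ (a ∘ σ) = true) :
    (⟨n, f⟩ : BoolFun) ∈ Θ :=
  hΘ.2 _ hθ _ hf (.tail (.single (Or.inl (.intro fun a => bool_le_iff.2 (h a))))
    (Or.inr ⟨σ, rfl⟩ : Minorant (⟨n, fun a => θ (a ∘ σ)⟩ : BoolFun) ⟨m, θ⟩ ∨ _))

theorem mem_of_le_closure (hΘ : Θ ∈ ideals (MinMinC C) k) {n : ℕ+}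
    {θ u f : (Fin n → Bool) → Bool} (hθ : (⟨n, θ⟩ : BoolFun) ∈ Θ)
    (hu : IsClosureOf C ⟨n, u⟩ ⟨n, θ⟩) (hf : (⟨n, f⟩ : BoolFun) ∈ atMost k)
    (h : ∀ a, f a = true → u a = true) : (⟨n, f⟩ : BoolFun) ∈ Θ :=
  hΘ.2 _ hθ _ hf (.tail (.single (Or.inl (.intro fun a => bool_le_iff.2 (h a))))
    (Or.inr (Or.inr hu)))

theorem eq_atMost_of_oneFun_mem (hΘ : Θ ∈ ideals MinMin k) (h : oneFun ∈ Θ) : Θ = atMost k :=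
  hΘ.1.antisymm fun ⟨_, _⟩ hf => mem_of_le_minor hΘ h (fun _ => 0) hf fun _ _ => rfl

theorem constZero_subset (hΘ : Θ ∈ ideals MinMin k) (h : Θ.Nonempty) : constZero ⊆ Θ := by
  rintro ⟨n, f⟩ hf
  obtain ⟨⟨m, θ⟩, hθ⟩ := h
  exact mem_of_le_minor hΘ hθ (fun _ => 0) (constZero_subset_atMost hf)
    fun a ha => absurd (ha.symm.trans (hf a)) (by simp)

theorem exists_true_point (hΘ : Θ ∈ ideals MinMin k) (hzero : Θ ≠ constZero) (h : Θ.Nonempty) :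
    ∃ (n : ℕ+) (θ : (Fin n → Bool) → Bool) (a : _), (⟨n, θ⟩ : BoolFun) ∈ Θ ∧ θ a = true := by
  by_contra hc
  push Not at hc
  exact hzero ((constZero_subset hΘ h).antisymm' fun f hf a => by simpa using hc f.1 f.2 a hf)

/-- The class of all functions below some member of `K`, of which the shadow is the part with at
most `k` true points, is closed under minorants and minors. -/
theorem exists_majorant_of_minorant_or_minor (hK : classComp K clProj ⊆ K) {f g : BoolFun}
    (h : Minorant f g ∨ Minor f g)
    (hg : ∃ u, (⟨g.1, u⟩ : BoolFun) ∈ K ∧ ∀ a, g.2 a = true → u a = true) :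
    ∃ u, (⟨f.1, u⟩ : BoolFun) ∈ K ∧ ∀ a, f.2 a = true → u a = true := by
  obtain ⟨u, hu, hgu⟩ := hg
  rcases h with h | ⟨σ, hσ⟩
  · cases h with | intro h =>
    exact ⟨u, hu, fun a ha => hgu a (bool_le_iff.1 (h a) ha)⟩
  · refine ⟨_, minor_mem hK hu σ, fun a ha => hgu _ ?_⟩
    rwa [hσ] at ha

theorem shadow_mem_ideals (hK : classComp K clProj ⊆ K) : shadow k K ∈ ideals MinMin k :=
  inter_atMost_mem_ideals
    (D := {f | ∃ u, (⟨f.1, u⟩ : BoolFun) ∈ K ∧ ∀ a, f.2 a = true → u a = true})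
    fun _ _ h => exists_majorant_of_minorant_or_minor hK h

/-- If every member of `K` lies below a member of `K` that belongs to `C`, then the shadow of `K`
is closed under `C`-closures. -/
theorem shadow_mem_ideals_minMinC (hK : classComp K clProj ⊆ K)
    (h : ∀ (n : ℕ+) (g : (Fin n → Bool) → Bool), (⟨n, g⟩ : BoolFun) ∈ K →
      ∃ u, (⟨n, u⟩ : BoolFun) ∈ K ∩ C ∧ ∀ a, g a = true → u a = true) :
    shadow k K ∈ ideals (MinMinC C) k := by
  refine inter_atMost_mem_ideals
    (D := {f | ∃ u, (⟨f.1, u⟩ : BoolFun) ∈ K ∧ ∀ a, f.2 a = true → u a = true}) ?_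
  rintro f g (h' | h' | ⟨⟨-, hl⟩⟩) hg
  · exact exists_majorant_of_minorant_or_minor hK (Or.inl h') hg
  · exact exists_majorant_of_minorant_or_minor hK (Or.inr h') hg
  · obtain ⟨u, hu, hgu⟩ := hg
    obtain ⟨v, hv, huv⟩ := h _ u hu
    exact ⟨v, hv.1, fun a => bool_le_iff.1
      (hl ⟨fun a => bool_le_iff.2 fun ha => huv a (hgu a ha), hv.2⟩ a)⟩

theorem subset_clUT_shadow : K ⊆ clUT k (shadow k K) := by
  classical
  rintro ⟨n, f⟩ hf T hT hT'
  refine ⟨⟨n, fun a => decide (a ∈ T)⟩, ⟨atMost_of_subset hT (by simp), f, hf, ?_⟩, id, ?_⟩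
  · simpa using hT'
  · simp

theorem subset_clUT : Θ ⊆ clUT k Θ := fun f hf _ _ hT' =>
  ⟨f, hf, id, hT'⟩

theorem shadow_clUT_inter_subset (hΘ : Θ ∈ ideals MinMin k) :
    shadow k (clUT k Θ ∩ X) ⊆ Θ := by
  rintro ⟨n, f⟩ ⟨hf, g, hg, hfg⟩
  obtain ⟨T, hT, hTf⟩ := exists_finset_of_atMost hf
  obtain ⟨θ, hθ, τ, h⟩ := hg.1 T hT fun a ha => hfg a ((hTf a).1 ha)
  exact mem_of_le_minor hΘ hθ τ hf fun a ha => h a ((hTf a).2 ha)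

/-- A function below which all functions with at most `k` true points belong to `Θ`
belongs to `U^k(Θ)`. -/
theorem mem_clUT_of_minorants {n : ℕ+} {u : (Fin n → Bool) → Bool}
    (h : ∀ f, (⟨n, f⟩ : BoolFun) ∈ atMost k → (∀ a, f a = true → u a = true) →
      (⟨n, f⟩ : BoolFun) ∈ Θ) : (⟨n, u⟩ : BoolFun) ∈ clUT k Θ := by
  classical
  intro T hT hT'
  exact ⟨⟨n, fun a => decide (a ∈ T)⟩, h _ (atMost_of_subset hT (by simp)) (by simpa using hT'),
    id, by simp⟩

theorem closure_mem_clUT (hΘ : Θ ∈ ideals (MinMinC C) k) {n : ℕ+} {θ u : (Fin n → Bool) → Bool}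
    (hθ : (⟨n, θ⟩ : BoolFun) ∈ Θ) (hu : IsClosureOf C ⟨n, u⟩ ⟨n, θ⟩) :
    (⟨n, u⟩ : BoolFun) ∈ clUT k Θ :=
  mem_clUT_of_minorants fun _ hf h => mem_of_le_closure hΘ hθ hu hf h

theorem mem_clUT_of_le_minor {n m : ℕ+} {θ : (Fin m → Bool) → Bool} {f : (Fin n → Bool) → Bool}
    (hθ : (⟨m, θ⟩ : BoolFun) ∈ Θ) (σ : Fin m → Fin n)
    (h : ∀ a, f a = true → θ (a ∘ σ) = true) : (⟨n, f⟩ : BoolFun) ∈ clUT k Θ :=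
  fun _ _ hT' => ⟨_, hθ, σ, fun a ha => h a (hT' a ha)⟩

theorem apply_comp_const {n m : ℕ+} (u : (Fin n → Bool) → Bool) (a : Fin m → Bool) (i : Fin m) :
    u (a ∘ fun _ => i) = bif a i then u (fun _ => true) else u (fun _ => false) := by
  change u (fun _ => a i) = _
  cases a i <;> rfl

theorem idFun_mem_of_apply (hK : classComp K clProj ⊆ K) {n : ℕ+}
    {u : (Fin n → Bool) → Bool} (hu : (⟨n, u⟩ : BoolFun) ∈ K)
    (h0 : u (fun _ => false) = false) (h1 : u (fun _ => true) = true) : idFun ∈ K := by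
  have h := minor_mem hK hu (fun _ => (0 : Fin (1 : ℕ+)))
  have e : idFun = ⟨1, fun a => u (a ∘ fun _ => (0 : Fin (1 : ℕ+)))⟩ := by
    unfold idFun
    congr 1
    funext a
    refine Eq.trans ?_ (apply_comp_const u a _).symm
    rw [h0, h1]
    cases a 0 <;> rfl
  rwa [e]

theorem oneFun_mem_of_apply (hK : classComp K clProj ⊆ K) {n : ℕ+}
    {u : (Fin n → Bool) → Bool} (hu : (⟨n, u⟩ : BoolFun) ∈ K)
    (h0 : u (fun _ => false) = true) (h1 : u (fun _ => true) = true) : oneFun ∈ K := by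
  have h := minor_mem hK hu (fun _ => (0 : Fin (1 : ℕ+)))
  have e : oneFun = ⟨1, fun a => u (a ∘ fun _ => (0 : Fin (1 : ℕ+)))⟩ := by
    unfold oneFun
    congr 1
    funext a
    refine Eq.trans ?_ (apply_comp_const u a _).symm
    rw [h0, h1]
    cases a 0 <;> rfl
  rwa [e]

/-- A member of `U^k(Θ)` with value `1` at both constant tuples has the constant `1` as a minor,
and its two true points are seen by `Θ` because `k ≥ 2`. -/
theorem oneFun_mem_of_mem_clUT (hk : 2 ≤ k) (hΘ : Θ ∈ ideals MinMin k) {n : ℕ+}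
    {u : (Fin n → Bool) → Bool} (hu : (⟨n, u⟩ : BoolFun) ∈ clUT k Θ)
    (h0 : u (fun _ => false) = true) (h1 : u (fun _ => true) = true) : oneFun ∈ Θ :=
  shadow_clUT_inter_subset (X := Set.univ) hΘ ⟨oneFun_mem_atMost hk, _,
    ⟨oneFun_mem_of_apply clUT_mem_clonoids.1 hu h0 h1, trivial⟩, fun _ h => h⟩

theorem constZero_subset_of_apply (hK : classComp K clProj ⊆ K) {n : ℕ+}
    {u : (Fin n → Bool) → Bool} (hu : (⟨n, u⟩ : BoolFun) ∈ K)
    (h0 : u (fun _ => false) = false) (h1 : u (fun _ => true) = false) : constZero ⊆ K := by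
  rintro ⟨m, z⟩ hz
  have h := minor_mem hK hu (fun _ => (0 : Fin m))
  have e : (⟨m, z⟩ : BoolFun) = ⟨m, fun a => u (a ∘ fun _ => (0 : Fin m))⟩ := by
    congr 1
    funext a
    have hz : z a = false := hz a
    simp [apply_comp_const, h0, h1, hz]
  rwa [e]

theorem proj_mem (hK : classComp K clProj ⊆ K) (h : idFun ∈ K) {n : ℕ+} (i : Fin n) :
    (⟨n, fun a => a i⟩ : BoolFun) ∈ K :=
  minor_mem hK h fun _ => i

/-- In one variable, only the identity and the constant `1` lie above the identity. -/
theorem idFun_mem_iff_mem_shadow (hk : 2 ≤ k) (hK : classComp K clProj ⊆ K) (h1 : oneFun ∉ K) :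
    idFun ∈ shadow k K ↔ idFun ∈ K := by
  refine ⟨?_, fun h => ⟨idFun_mem_atMost hk, _, h, fun _ h => h⟩⟩
  rintro ⟨-, g, hg, h⟩
  have hg1 : g (fun _ => true) = true := h _ rfl
  cases hg0 : g (fun _ => false) with
  | false => exact idFun_mem_of_apply hK hg hg0 hg1
  | true => exact absurd (oneFun_mem_of_apply hK hg hg0 hg1) h1

theorem oneFun_notMem_of_subset_clUT (hk : 2 ≤ k) (hΘ : Θ ∈ ideals MinMin k)
    (h1 : oneFun ∉ Θ) (hK : K ⊆ clUT k Θ) : oneFun ∉ K := fun h =>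
  h1 (oneFun_mem_of_mem_clUT hk hΘ (hK h) rfl rfl)

/-! ### Closures with respect to `T_{*1}`, `M` and `R` -/

theorem isClosureOf_clXI {n : ℕ+} (g : (Fin n → Bool) → Bool) :
    IsClosureOf clXI ⟨n, fun a => g a || decide (a = fun _ => true)⟩ ⟨n, g⟩ := by
  refine .intro ⟨⟨fun a => bool_le_iff.2 (by simp +contextual), by simp [clXI, valOne]⟩, ?_⟩
  rintro u ⟨hu, -, hu1⟩ a
  refine bool_le_iff.2 fun ha => ?_
  rcases (by simpa using ha : g a = true ∨ a = fun _ => true) with ha | rfl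
  · exact bool_le_iff.1 (hu a) ha
  · exact hu1

open Classical in
theorem isClosureOf_clM {n : ℕ+} (g : (Fin n → Bool) → Bool) :
    IsClosureOf clM ⟨n, fun a => decide (∃ b, b ≤ a ∧ g b = true)⟩ ⟨n, g⟩ := by
  refine .intro ⟨⟨fun a => bool_le_iff.2 fun ha => ?_, ?_⟩, ?_⟩
  · simpa using ⟨a, le_rfl, ha⟩
  · refine mem_clM.2 fun a b hab ha => ?_
    obtain ⟨c, hc, hgc⟩ := of_decide_eq_true ha
    exact decide_eq_true ⟨c, hc.trans hab, hgc⟩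
  · rintro u ⟨hu, hum⟩ a
    refine bool_le_iff.2 fun ha => ?_
    obtain ⟨c, hc, hgc⟩ := of_decide_eq_true ha
    exact mem_clM.1 hum c a hc (bool_le_iff.1 (hu c) hgc)

theorem isClosureOf_clR {n : ℕ+} (g : (Fin n → Bool) → Bool) :
    IsClosureOf clR ⟨n, fun a => g a || g fun i => !(a i)⟩ ⟨n, g⟩ := by
  refine .intro ⟨⟨fun a => bool_le_iff.2 (by simp +contextual), fun a => ?_⟩, ?_⟩
  · simp [Bool.or_comm]
  · rintro u ⟨hu, hur⟩ a
    refine bool_le_iff.2 fun ha => ?_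
    rcases (by simpa using ha : g a = true ∨ g (fun i => !(a i)) = true) with ha | ha
    · exact bool_le_iff.1 (hu a) ha
    · exact (hur a).trans (bool_le_iff.1 (hu _) ha)

/-! ### Classification of the clonoids with a given shadow -/

theorem exists_lt_of_ne_of_le {n : ℕ+} {a b : Fin n → Bool} (hne : a ≠ b)
    (hle : ¬ ∃ i, a i = true ∧ b i = false) : ∃ l, a l = false ∧ b l = true := by
  by_contra hc
  push Not at hle hc
  refine hne (funext fun i => ?_)
  have h1 := hle i
  have h2 := hc i
  revert h1 h2
  cases a i <;> cases b i <;> simp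

theorem exists_eq_true_of_ne {n : ℕ+} {a : Fin n → Bool} (h : a ≠ fun _ => false) :
    ∃ i, a i = true := by
  by_contra hc
  push Not at hc
  exact h (point_eq_zero hc)

theorem exists_eq_false_of_ne {n : ℕ+} {a : Fin n → Bool} (h : a ≠ fun _ => true) :
    ∃ i, a i = false := by
  by_contra hc
  push Not at hc
  exact h (point_eq_one fun i => by simpa using hc i)

theorem ne_of_apply_eq {α β : Type*} {h : α → β} {a b : α} {c d : β} (ha : h a = c)
    (hb : h b = d) (hcd : c ≠ d) : a ≠ b := by
  rintro rfl
  exact hcd (ha.symm.trans hb)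

theorem neg_proj_mem (hK : classComp K clProj ⊆ K) {m : ℕ+} {g : (Fin m → Bool) → Bool}
    (hg : (⟨m, g⟩ : BoolFun) ∈ K) (h0 : g (fun _ => false) = true)
    (h1 : g (fun _ => true) = false) {n : ℕ+} (i : Fin n) :
    (⟨n, fun a => !(a i)⟩ : BoolFun) ∈ K := by
  have h := minor_mem hK hg (fun _ => i)
  have e : (fun a : Fin n → Bool => g (a ∘ fun _ => i)) = fun a => !(a i) := by
    funext a
    rw [apply_comp_const g a i, h0, h1]
    cases a i <;> rfl
  rwa [e] at h

/-- If a clonoid contains the identity and some negated variable, it is determined by its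
shadow. -/
theorem clUT_shadow_subset_of_neg (hk : 2 ≤ k) (hK : K ∈ clonoids clProj (clMU01 k))
    (hx : idFun ∈ K) {m : ℕ+} {g : (Fin m → Bool) → Bool} (hg : (⟨m, g⟩ : BoolFun) ∈ K)
    (h0 : g (fun _ => false) = true) (h1 : g (fun _ => true) = false) :
    clUT k (shadow k K) ⊆ K := by
  rintro ⟨n, h⟩ hh
  refine mem_of_interpolation (by lia) hK hh ?_ ?_
  · intro a b ha hb
    by_cases hab : ∃ i, a i = true ∧ b i = false
    · obtain ⟨i, hai, hbi⟩ := hab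
      exact ⟨_, proj_mem hK.1 hx i, hai, hbi⟩
    · obtain ⟨l, hal, hbl⟩ := exists_lt_of_ne_of_le (ne_of_apply_eq ha hb (by simp)) hab
      exact ⟨_, neg_proj_mem hK.1 hg h0 h1 l, by simp [hal], by simp [hbl]⟩
  · intro b _
    cases hb : b 0 with
    | false => exact ⟨_, proj_mem hK.1 hx 0, hb⟩
    | true => exact ⟨_, neg_proj_mem hK.1 hg h0 h1 0, by simp [hb]⟩

/-- A clonoid containing the identity, but not the constant `1`, is determined by its shadow
unless it consists of members of `T₀₁` and constants `0`. -/
theorem clUT_shadow_subset_of_idFun (hk : 2 ≤ k) (hK : K ∈ clonoids clProj (clMU01 k))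
    (hx : idFun ∈ K) (h1 : oneFun ∉ K) (hX : ¬ K ⊆ clOI ∪ constZero) :
    clUT k (shadow k K) ⊆ K := by
  obtain ⟨⟨m, g⟩, hg, hgX⟩ := Set.not_subset.1 hX
  have hg1 : g (fun _ => true) = false := by
    rw [Bool.eq_false_iff]
    intro hg1
    cases hg0 : g (fun _ => false) with
    | true => exact h1 (oneFun_mem_of_apply hK.1 hg hg0 hg1)
    | false => exact hgX (Or.inl (mem_clOI.2 ⟨hg0, hg1⟩))
  by_cases hneg : ∃ (m : ℕ+) (g : (Fin m → Bool) → Bool), (⟨m, g⟩ : BoolFun) ∈ K ∧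
      g (fun _ => false) = true
  · obtain ⟨m, g, hg, hg0⟩ := hneg
    refine clUT_shadow_subset_of_neg hk hK hx hg hg0 (Bool.eq_false_iff.2 fun hg1 => ?_)
    exact h1 (oneFun_mem_of_apply hK.1 hg hg0 hg1)
  push Not at hneg
  have hzero : ∀ {n : ℕ+} {u : (Fin n → Bool) → Bool}, (⟨n, u⟩ : BoolFun) ∈ K →
      u (fun _ => false) = false := fun hu => by simpa using hneg _ _ hu
  obtain ⟨c, hc⟩ : ∃ c, g c = true := by
    by_contra hc
    push Not at hc
    exact hgX (Or.inr fun a => by simpa using hc a)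
  rintro ⟨n, h⟩ hh
  refine mem_of_interpolation (by lia) hK hh ?_ ?_
  · intro a b ha hb
    by_cases hab : ∃ i, a i = true ∧ b i = false
    · obtain ⟨i, hai, hbi⟩ := hab
      exact ⟨_, proj_mem hK.1 hx i, hai, hbi⟩
    obtain ⟨l, hal, hbl⟩ := exists_lt_of_ne_of_le (ne_of_apply_eq ha hb (by simp)) hab
    obtain ⟨u, hu, hua⟩ := exists_mem_of_mem_clUT_shadow hK.1 hh {a} (by simp; lia) (by simpa)
    obtain ⟨i, hi⟩ := exists_eq_true_of_ne
      (ne_of_apply_eq (hua a (by simp)) (hzero hu) (by simp))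
    have hbi : b i = true := by simpa [hi] using not_exists.1 hab i
    -- the minor of `g` that maps `a` to the true point `c` and `b` to `1`
    refine ⟨_, minor_mem hK.1 hg (fun p => if c p then i else l), ?_, ?_⟩
    · convert hc using 2
      funext p
      by_cases hp : c p = true <;> simp [hp, hi, hal]
    · convert hg1 using 2
      funext p
      by_cases hp : c p = true <;> simp [hp, hbi, hbl]
  · intro b _
    exact ⟨fun _ => false,
      constZero_subset_of_apply hK.1 hg (hzero hg) hg1 (fun _ => rfl), rfl⟩

theorem proj_mem_of_ne_one (hK : classComp K clProj ⊆ K) (hx : idFun ∈ K) {n : ℕ+}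
    {b : Fin n → Bool} (hb : b ≠ fun _ => true) :
    ∃ g, (⟨n, g⟩ : BoolFun) ∈ K ∧ g b = false :=
  let ⟨i, hi⟩ := exists_eq_false_of_ne hb
  ⟨_, proj_mem hK hx i, hi⟩

/-- If a clonoid in `T₀₁ ∪ C₀` contains the identity and some function that is not monotone, then
minors of the latter separate all pairs `a < b` of nonconstant tuples. -/
theorem clUT_shadow_inter_clOI_subset (hk : 2 ≤ k) (hK : K ∈ clonoids clProj (clMU01 k))
    (hx : idFun ∈ K) (hX : K ⊆ clOI ∪ constZero) (hM : ¬ K ⊆ clM) :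
    clUT k (shadow k K) ∩ clOI ⊆ K := by
  obtain ⟨⟨m, g⟩, hg, hgM⟩ := Set.not_subset.1 hM
  rw [mem_clM] at hgM
  push Not at hgM
  obtain ⟨c, d, hcd, hgc, hgd⟩ := hgM
  have hgd : g d = false := by simpa using hgd
  obtain ⟨hg0, hg1⟩ := mem_clOI.1 ((hX hg).resolve_right fun h => by simpa [hgc] using h c)
  rintro ⟨n, h⟩ ⟨hh, hh'⟩
  obtain ⟨hh0, hh1⟩ := mem_clOI.1 hh'
  refine mem_of_interpolation (by lia) hK hh ?_ ?_
  · intro a b ha hb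
    by_cases hab : ∃ i, a i = true ∧ b i = false
    · obtain ⟨i, hai, hbi⟩ := hab
      exact ⟨_, proj_mem hK.1 hx i, hai, hbi⟩
    obtain ⟨l, hal, hbl⟩ := exists_lt_of_ne_of_le (ne_of_apply_eq ha hb (by simp)) hab
    obtain ⟨i, hai⟩ := exists_eq_true_of_ne (ne_of_apply_eq ha hh0 (by simp))
    obtain ⟨j, hbj⟩ := exists_eq_false_of_ne (ne_of_apply_eq hb hh1 (by simp))
    have hbi : b i = true := by simpa [hai] using not_exists.1 hab i
    have haj : a j = false := by simpa [hbj] using not_exists.1 hab j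
    -- the minor of `g` that maps `a` to `c` and `b` to `d`
    refine ⟨_, minor_mem hK.1 hg (fun p => if c p then i else if d p then l else j), ?_, ?_⟩
    · convert hgc using 2
      funext p
      by_cases hp : c p = true <;> by_cases hq : d p = true <;> simp [hp, hq, hai, haj, hal]
    · convert hgd using 2
      funext p
      have := bool_le_iff.1 (hcd p)
      by_cases hp : c p = true
      · simp [hp, this hp, hbi]
      · by_cases hq : d p = true <;> simp [hp, hq, hbj, hbl]
  · intro b hb
    exact proj_mem_of_ne_one hK.1 hx (ne_of_apply_eq hb hh1 (by simp))

/-- For a monotone function, projections separate its true points from its false points. -/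
theorem clUT_shadow_inter_clM01_subset (hk : 2 ≤ k) (hK : K ∈ clonoids clProj (clMU01 k))
    (hx : idFun ∈ K) : clUT k (shadow k K) ∩ clM01 ⊆ K := by
  rintro ⟨n, h⟩ ⟨hh, hh'⟩
  rw [clM01_eq] at hh'
  obtain ⟨hh0, hh1⟩ := mem_clOI.1 hh'.2
  refine mem_of_interpolation (by lia) hK hh ?_ ?_
  · intro a b ha hb
    by_cases hab : ∃ i, a i = true ∧ b i = false
    · obtain ⟨i, hai, hbi⟩ := hab
      exact ⟨_, proj_mem hK.1 hx i, hai, hbi⟩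
    · refine absurd (mem_clM.1 hh'.1 a b (fun i => bool_le_iff.2 fun hi => ?_) ha) (by simp [hb])
      simpa [hi] using not_exists.1 hab i
  · intro b hb
    exact proj_mem_of_ne_one hK.1 hx (ne_of_apply_eq hb hh1 (by simp))

theorem clM0_subset : clM0 ⊆ clM01 ∪ constZero := by
  rintro ⟨n, f⟩ ⟨hf, hf0⟩
  by_cases h1 : f (fun _ => true) = true
  · exact Or.inl (clM01_eq ▸ ⟨hf, mem_clOI.2 ⟨hf0, h1⟩⟩)
  · refine Or.inr fun a => Bool.eq_false_iff.2 fun ha => h1 ?_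
    exact mem_clM.1 hf a _ (fun i => Bool.le_true _) ha

theorem clUT_shadow_inter_clM0_subset (hk : 2 ≤ k) (hK : K ∈ clonoids clProj (clMU01 k))
    (hx : idFun ∈ K) (h0 : constZero ⊆ K) : clUT k (shadow k K) ∩ clM0 ⊆ K := fun _ hf =>
  (clM0_subset hf.2).elim (fun h => clUT_shadow_inter_clM01_subset hk hK hx ⟨hf.1, h⟩)
    fun h => h0 h

/-- For a point `a` that is not constant, and `b` other than `a` and its complement, some pair of
coordinates distinguishes the values of `a`, but not those of `b`. -/
theorem exists_eq_of_ne_of_ne_compl {n : ℕ+} {a b : Fin n → Bool} {i j : Fin n}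
    (hi : a i = false) (hj : a j = true) (h1 : a ≠ b) (h2 : b ≠ fun p => !(a p)) :
    ∃ i j, a i = false ∧ a j = true ∧ b i = b j := by
  by_contra hc
  push Not at hc
  have hij := hc i j hi hj
  cases hbi : b i with
  | false =>
    rw [hbi] at hij
    have hbj : b j = true := by simpa using hij
    refine h1 (funext fun p => ?_)
    cases hp : a p with
    | false => have := hc p j hp hj; rw [hbj] at this; simpa using this
    | true => have := hc i p hi hp; rw [hbi] at this; simpa using this
  | true =>
    rw [hbi] at hij
    have hbj : b j = false := by simpa using hij
    refine h2 (funext fun p => ?_)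
    cases hp : a p with
    | false => have := hc p j hp hj; rw [hbj] at this; simpa using this
    | true => have := hc i p hi hp; rw [hbi] at this; simpa using this

/-- The common part of the analysis of the clonoids all of whose members vanish at both constant
tuples: only the complementary pairs of points need to be separated. -/
theorem mem_of_interpolation_compl (hk : 2 ≤ k) (hK : K ∈ clonoids clProj (clMU01 k))
    (hval : K ⊆ val Set.univ false false) {n : ℕ+} {h : (Fin n → Bool) → Bool}
    (hh : (⟨n, h⟩ : BoolFun) ∈ clUT k (shadow k K))
    (hsep : ∀ a i j, a i = false → a j = true → h a = true → h (fun p => !(a p)) = false →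
      ∃ g, (⟨n, g⟩ : BoolFun) ∈ K ∧ g a = true ∧ g (fun p => !(a p)) = false) :
    (⟨n, h⟩ : BoolFun) ∈ K := by
  have hT := exists_mem_of_mem_clUT_shadow hK.1 hh
  have h0 : ∀ {n : ℕ+} {u : (Fin n → Bool) → Bool}, (⟨n, u⟩ : BoolFun) ∈ K →
      u (fun _ => false) = false := fun hu => (hval hu).1.2
  have h1 : ∀ {n : ℕ+} {u : (Fin n → Bool) → Bool}, (⟨n, u⟩ : BoolFun) ∈ K →
      u (fun _ => true) = false := fun hu => (hval hu).2.2
  refine mem_of_interpolation (by lia) hK hh ?_ ?_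
  · intro a b ha hb
    obtain ⟨u, hu, hua⟩ := hT {a} (by simp; lia) (by simpa)
    have hua := hua a (by simp)
    obtain ⟨i, hi⟩ := exists_eq_false_of_ne (ne_of_apply_eq hua (h1 hu) (by simp))
    obtain ⟨j, hj⟩ := exists_eq_true_of_ne (ne_of_apply_eq hua (h0 hu) (by simp))
    by_cases hab : b = fun p => !(a p)
    · subst hab
      exact hsep a i j hi hj ha hb
    obtain ⟨i, j, hi, hj, hbij⟩ :=
      exists_eq_of_ne_of_ne_compl hi hj (ne_of_apply_eq ha hb (by simp)) hab
    -- the minor of `u` that fixes `a` and maps `b` to a constant tuple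
    refine ⟨_, minor_mem hK.1 hu (fun p => if a p then j else i), ?_, ?_⟩
    · convert hua using 2
      funext p
      by_cases hp : a p = true <;> simp [hp, hi, hj]
    · have e : (b ∘ fun p => if a p then j else i) = fun _ => b j := by
        funext p
        by_cases hp : a p = true <;> simp [hp, hbij]
      rw [e]
      cases b j
      · exact h0 hu
      · exact h1 hu
  · intro b _
    obtain ⟨u, hu, -⟩ := hT ∅ (by simp) (by simp)
    exact ⟨fun _ => false,
      constZero_subset_of_apply hK.1 hu (h0 hu) (h1 hu) (fun _ => rfl), rfl⟩

theorem clUT_shadow_inter_clR_subset (hk : 2 ≤ k) (hK : K ∈ clonoids clProj (clMU01 k))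
    (hval : K ⊆ val Set.univ false false) : clUT k (shadow k K) ∩ clR ⊆ K := by
  rintro ⟨n, h⟩ ⟨hh, hR⟩
  refine mem_of_interpolation_compl hk hK hval hh fun a _ _ _ _ ha ha' => ?_
  exact absurd (ha.symm.trans ((hR a).trans ha')) (by simp)

theorem clUT_shadow_subset_of_not_subset_clR (hk : 2 ≤ k)
    (hK : K ∈ clonoids clProj (clMU01 k)) (hval : K ⊆ val Set.univ false false)
    (hR : ¬ K ⊆ clR) : clUT k (shadow k K) ⊆ K := by
  obtain ⟨⟨m, g⟩, hg, hgR⟩ := Set.not_subset.1 hR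
  obtain ⟨c, hc, hc'⟩ : ∃ c, g c = true ∧ g (fun p => !(c p)) = false := by
    by_contra hc
    push Not at hc
    refine hgR fun a => ?_
    change g a = g fun p => !(a p)
    have h1 := hc a
    have h2 := hc fun p => !(a p)
    simp only [Bool.not_not] at h2
    revert h1 h2
    cases g a <;> cases g (fun p => !(a p)) <;> simp
  rintro ⟨n, h⟩ hh
  refine mem_of_interpolation_compl hk hK hval hh fun a i j hi hj _ _ => ?_
  -- the minor of `g` that maps `a` to `c`, hence the complement of `a` to that of `c`
  refine ⟨_, minor_mem hK.1 hg (fun p => if c p then j else i), ?_, ?_⟩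
  · convert hc using 2
    funext p
    by_cases hp : c p = true <;> simp [hp, hi, hj]
  · convert hc' using 2
    funext p
    by_cases hp : c p = true <;> simp [hp, hi, hj]

/-! ### Shadows of the restricted classes -/

theorem mem_of_mem_clUT (hΘ : Θ ∈ ideals MinMin k) {f : BoolFun} (hf : f ∈ atMost k)
    (h : f ∈ clUT k Θ) : f ∈ Θ :=
  shadow_clUT_inter_subset (X := Set.univ) hΘ ⟨hf, _, ⟨h, trivial⟩, fun _ h => h⟩

theorem shadow_clUT (hΘ : Θ ∈ ideals MinMin k) : shadow k (clUT k Θ) = Θ :=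
  (Set.inter_univ (clUT k Θ) ▸ shadow_clUT_inter_subset hΘ).antisymm fun _ hf =>
    ⟨hΘ.1 hf, _, subset_clUT hf, fun _ h => h⟩

/-- `U^k(Θ) ∩ X` has shadow `Θ` if each member of `Θ` lies below a member of this class. -/
theorem shadow_clUT_inter (hΘ : Θ ∈ ideals MinMin k)
    (h : ∀ (n : ℕ+) (θ : (Fin n → Bool) → Bool), (⟨n, θ⟩ : BoolFun) ∈ Θ →
      ∃ u, (⟨n, u⟩ : BoolFun) ∈ clUT k Θ ∩ X ∧ ∀ a, θ a = true → u a = true) :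
    shadow k (clUT k Θ ∩ X) = Θ :=
  (shadow_clUT_inter_subset hΘ).antisymm fun f hf => ⟨hΘ.1 hf, h f.1 f.2 hf⟩

theorem shadow_clUT_inter_clOI (hk : 2 ≤ k) (hΘ : Θ ∈ ideals (MinMinC clXI) k)
    (h1 : oneFun ∉ Θ) : shadow k (clUT k Θ ∩ clOI) = Θ := by
  have hΘ' := ideals_minMinC_subset hΘ
  refine shadow_clUT_inter hΘ' fun n θ hθ =>
    ⟨_, ⟨closure_mem_clUT hΘ hθ (isClosureOf_clXI θ), ?_⟩, by simp +contextual⟩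
  refine mem_clOI.2 ⟨Bool.eq_false_iff.2 fun h0 => h1 ?_, by simp⟩
  exact oneFun_mem_of_mem_clUT hk hΘ' (closure_mem_clUT hΘ hθ (isClosureOf_clXI θ)) h0 (by simp)

theorem shadow_clUT_inter_clOI_union (hk : 2 ≤ k) (hΘ : Θ ∈ ideals (MinMinC clXI) k)
    (h1 : oneFun ∉ Θ) : shadow k (clUT k Θ ∩ (clOI ∪ constZero)) = Θ :=
  (shadow_clUT_inter_subset (ideals_minMinC_subset hΘ)).antisymm <| by
    conv_lhs => rw [← shadow_clUT_inter_clOI hk hΘ h1]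
    exact shadow_mono (Set.inter_subset_inter_right _ Set.subset_union_left)

theorem shadow_clUT_inter_clM0 (hk : 2 ≤ k) (hΘ : Θ ∈ ideals (MinMinC clM) k)
    (h1 : oneFun ∉ Θ) : shadow k (clUT k Θ ∩ clM0) = Θ := by
  have hΘ' := ideals_minMinC_subset hΘ
  refine shadow_clUT_inter hΘ' fun n θ hθ => ?_
  have hu := isClosureOf_clM θ
  generalize (fun a => _ : (Fin n → Bool) → Bool) = u at hu
  have hU := closure_mem_clUT hΘ hθ hu
  obtain ⟨⟨⟨hθu, hM⟩, -⟩⟩ := hu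
  refine ⟨u, ⟨hU, hM, Bool.eq_false_iff.2 fun h0 => h1 ?_⟩, fun a => bool_le_iff.1 (hθu a)⟩
  exact oneFun_mem_of_mem_clUT hk hΘ' hU h0 (mem_clM.1 hM _ _ (fun _ => Bool.false_le _) h0)

/-- The `M`-closure of a constant `0` is not in `M₀₁`; here a projection is a majorant. -/
theorem shadow_clUT_inter_clM01 (hk : 2 ≤ k) (hΘ : Θ ∈ ideals (MinMinC clM) k)
    (h1 : oneFun ∉ Θ) (hx : idFun ∈ Θ) : shadow k (clUT k Θ ∩ clM01) = Θ := by
  have hΘ' := ideals_minMinC_subset hΘ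
  refine shadow_clUT_inter hΘ' fun n θ hθ => ?_
  rw [← shadow_clUT_inter_clM0 hk hΘ h1] at hθ
  obtain ⟨-, u, hu, hθu⟩ := hθ
  rcases clM0_subset hu.2 with hu' | hu'
  · exact ⟨u, ⟨hu.1, hu'⟩, hθu⟩
  · refine ⟨fun a => a 0, ⟨proj_mem clUT_mem_clonoids.1 (subset_clUT hx) 0, ?_⟩, fun a ha => ?_⟩
    · exact clM01_eq ▸ ⟨mem_clM.2 fun a b hab => bool_le_iff.1 (hab 0), mem_clOI.2 ⟨rfl, rfl⟩⟩
    · exact absurd ((hθu a ha).symm.trans (hu' a)) (by simp)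

theorem shadow_clUT_inter_clR00 (hk : 2 ≤ k) (hΘ : Θ ∈ ideals (MinMinC clR) k)
    (h1 : oneFun ∉ Θ) : shadow k (clUT k Θ ∩ clR00) = Θ := by
  have hΘ' := ideals_minMinC_subset hΘ
  refine shadow_clUT_inter hΘ' fun n θ hθ => ?_
  have hu := isClosureOf_clR θ
  generalize (fun a => _ : (Fin n → Bool) → Bool) = u at hu
  have hU := closure_mem_clUT hΘ hθ hu
  obtain ⟨⟨⟨hθu, hR⟩, -⟩⟩ := hu
  have h01 : u (fun _ => false) = u (fun _ => true) := hR _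
  have h0 : u (fun _ => false) = false := Bool.eq_false_iff.2 fun h0 =>
    h1 (oneFun_mem_of_mem_clUT hk hΘ' hU h0 (h01 ▸ h0))
  exact ⟨u, ⟨hU, ⟨hR, h0⟩, ⟨hR, h01.symm.trans h0⟩⟩, fun a => bool_le_iff.1 (hθu a)⟩

theorem shadow_mem_ideals_clXI (hK : classComp K clProj ⊆ K) (hx : idFun ∈ K)
    (hX : K ⊆ clOI ∪ constZero) : shadow k K ∈ ideals (MinMinC clXI) k := by
  refine shadow_mem_ideals_minMinC hK fun n g hg => ?_
  rcases hX hg with h | h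
  · exact ⟨g, ⟨hg, trivial, h.2.2⟩, fun _ h => h⟩
  · exact ⟨_, ⟨proj_mem hK hx 0, trivial, rfl⟩,
      fun a ha => absurd (ha.symm.trans (h a)) (by simp)⟩

theorem shadow_mem_ideals_of_subset (hK : classComp K clProj ⊆ K) (hC : K ⊆ C) :
    shadow k K ∈ ideals (MinMinC C) k :=
  shadow_mem_ideals_minMinC hK fun _ g hg => ⟨g, ⟨hg, hC hg⟩, fun _ h => h⟩

/-- The `T_{*1}`-closure of the unary constant `0` is the identity. -/
theorem idFun_mem_of_mem_ideals_clXI (hk : 2 ≤ k) (hΘ : Θ ∈ ideals (MinMinC clXI) k)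
    (hne : Θ.Nonempty) : idFun ∈ Θ := by
  have h0 : (⟨1, fun _ => false⟩ : BoolFun) ∈ Θ :=
    constZero_subset (ideals_minMinC_subset hΘ) hne fun _ => rfl
  refine mem_of_le_closure hΘ h0 (isClosureOf_clXI _) (idFun_mem_atMost hk) fun a ha => ?_
  simp only [Bool.false_or, decide_eq_true_eq]
  funext i
  rw [fin_one_eq_zero i]
  exact ha

theorem idFun_mem_of_mem_ideals_clM (hk : 2 ≤ k) (hΘ : Θ ∈ ideals (MinMinC clM) k)
    (h1 : oneFun ∉ Θ) {n : ℕ+} {θ : (Fin n → Bool) → Bool} {a : Fin n → Bool}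
    (hθ : (⟨n, θ⟩ : BoolFun) ∈ Θ) (ha : θ a = true) : idFun ∈ Θ := by
  rw [← shadow_clUT_inter_clM0 hk hΘ h1] at hθ
  obtain ⟨-, u, hu, hθu⟩ := hθ
  refine mem_of_mem_clUT (ideals_minMinC_subset hΘ) (idFun_mem_atMost hk) ?_
  exact idFun_mem_of_apply clUT_mem_clonoids.1 hu.1 hu.2.2
    (mem_clM.1 hu.2.1 a _ (fun _ => Bool.le_true _) (hθu a ha))

/-- The value `1` at a constant tuple would give the `R`-closure the minor `1`. -/
theorem apply_const_of_mem_ideals_clR (hk : 2 ≤ k) (hΘ : Θ ∈ ideals (MinMinC clR) k)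
    (h1 : oneFun ∉ Θ) {n : ℕ+} {θ : (Fin n → Bool) → Bool} (hθ : (⟨n, θ⟩ : BoolFun) ∈ Θ) :
    θ (fun _ => false) = false ∧ θ (fun _ => true) = false := by
  rw [← shadow_clUT_inter_clR00 hk hΘ h1] at hθ
  obtain ⟨-, u, hu, hθu⟩ := hθ
  have h0 := hu.2.1.2
  have h1 := hu.2.2.2
  refine ⟨Bool.eq_false_iff.2 fun h => ?_, Bool.eq_false_iff.2 fun h => ?_⟩
  · exact absurd ((hθu _ h).symm.trans h0) (by simp)
  · exact absurd ((hθu _ h).symm.trans h1) (by simp)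

/-! ### Lower covers -/

theorem isLowerCover_iff {α : Type*} {𝓛 : Set (Set α)} {L K : Set α} :
    IsLowerCover 𝓛 L K ↔ L ∈ 𝓛 ∧ K ∈ 𝓛 ∧ L ⊂ K ∧ ∀ M ∈ 𝓛, L ⊂ M → ¬ M ⊂ K := by
  constructor
  · rintro ⟨hL, hK, h1, h2⟩
    exact ⟨hL, hK, h1, fun M hM h3 h4 => h2 (c := ⟨M, hM⟩) h3 h4⟩
  · rintro ⟨hL, hK, h1, h2⟩
    exact ⟨hL, hK, h1, fun c h3 h4 => h2 c.1 c.2 h3 h4⟩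

/-- The method by which all lower covers are found. Let `F` embed the order ideal generated by `Θ`
in a family `J` into a family `𝓚` in such a way that `s` is a left inverse of `F` and that each
`L ∈ 𝓚` below `F Θ` lies below `F (s L)`. The lower covers of `F Θ` are then the images of the
lower covers of `Θ` together with the maximal members below `F Θ` that `s` maps to `Θ`.

The members `L` of `𝓚` for which `s L` behaves badly may be exempted if they are neither
lower covers of `F Θ` nor above the image of a member of `J`. -/
theorem hasLowerCovers_of_embedding {α β : Type*} {𝓚 : Set (Set α)} {J : Set (Set β)}
    {F : Set β → Set α} {s : Set α → Set β} {Θ : Set β} {S : Set (Set α)}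
    (hF : Monotone F) (hs : Monotone s) (hΘ : Θ ∈ J)
    (hFJ : ∀ Ψ ∈ J, Ψ ⊆ Θ → F Ψ ∈ 𝓚) (hsF : ∀ Ψ ∈ J, Ψ ⊆ Θ → s (F Ψ) = Ψ)
    (hsub : ∀ L ∈ 𝓚, L ⊆ F Θ → (s L ∈ J ∧ L ⊆ F (s L)) ∨
      ((∃ L' ∈ 𝓚, L ⊂ L' ∧ L' ⊂ F Θ) ∧ ∀ Ψ ∈ J, Ψ ⊆ Θ → ¬ F Ψ ⊆ L))
    (hmax : ∀ L ∈ 𝓚, L ⊆ F Θ → s L = Θ → L ≠ F Θ → ∃ S₀ ∈ S, L ⊆ S₀)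
    (hS : ∀ S₀ ∈ S, S₀ ∈ 𝓚 ∧ S₀ ⊂ F Θ ∧ s S₀ = Θ)
    (hanti : ∀ S₀ ∈ S, ∀ S₁ ∈ S, S₀ ⊆ S₁ → S₀ = S₁)
    (hcov : ∀ Ψ, IsLowerCover J Ψ Θ → ∀ S₀ ∈ S, ¬ F Ψ ⊆ S₀) :
    HasLowerCovers 𝓚 (F Θ) ({L | ∃ Ψ, IsLowerCover J Ψ Θ ∧ L = F Ψ} ∪ S) := by
  refine ⟨hFJ Θ hΘ subset_rfl, fun L => ?_⟩
  rw [isLowerCover_iff]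
  have hle : ∀ L, L ⊆ F Θ → s L ⊆ Θ := fun L hL => hsF Θ hΘ subset_rfl ▸ hs hL
  constructor
  · rintro ⟨hL, -, hLΘ, hc⟩
    rcases hsub L hL hLΘ.1 with ⟨hJ, hLs⟩ | ⟨⟨L', hL', h1, h2⟩, -⟩
    swap
    · exact absurd h2 (hc L' hL' h1)
    by_cases hsL : s L = Θ
    · obtain ⟨S₀, hS₀, hLS⟩ := hmax L hL hLΘ.1 hsL hLΘ.ne
      right
      obtain ⟨h1, h2, -⟩ := hS S₀ hS₀
      rcases hLS.eq_or_ssubset with rfl | h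
      · exact hS₀
      · exact absurd h2 (hc S₀ h1 h)
    · have hlt : s L ⊂ Θ := (hle L hLΘ.1).ssubset_of_ne hsL
      have hstrict : ∀ Ψ ∈ J, Ψ ⊂ Θ → F Ψ ⊂ F Θ := fun Ψ hΨ h =>
        (hF h.1).ssubset_of_ne fun e => h.ne <| by
          rw [← hsF Ψ hΨ h.1, e, hsF Θ hΘ subset_rfl]
      have hLeq : L = F (s L) := by
        by_contra hne
        exact hc _ (hFJ _ hJ hlt.1) (hLs.ssubset_of_ne hne) (hstrict _ hJ hlt)
      refine Or.inl ⟨s L, isLowerCover_iff.2 ⟨hJ, hΘ, hlt, fun Ψ hΨ h1 h2 => ?_⟩, hLeq⟩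
      refine hc (F Ψ) (hFJ Ψ hΨ h2.1) ?_ (hstrict Ψ hΨ h2)
      refine (hLs.trans (hF h1.1)).ssubset_of_ne fun e => h1.ne ?_
      rw [e, hsF Ψ hΨ h2.1]
  · rintro (⟨Ψ, hcΨ, rfl⟩ | hLS)
    · obtain ⟨hΨ, -, hlt, hc⟩ := isLowerCover_iff.1 hcΨ
      refine ⟨hFJ Ψ hΨ hlt.1, hFJ Θ hΘ subset_rfl, (hF hlt.1).ssubset_of_ne fun e => hlt.ne ?_,
        fun M hM h1 h2 => ?_⟩
      · rw [← hsF Ψ hΨ hlt.1, e, hsF Θ hΘ subset_rfl]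
      rcases hsub M hM h2.1 with ⟨hJ, hMs⟩ | ⟨-, h⟩
      swap
      · exact h Ψ hΨ hlt.1 h1.1
      have hΨs : Ψ ⊆ s M := hsF Ψ hΨ hlt.1 ▸ hs h1.1
      by_cases hsM : s M = Θ
      · obtain ⟨S₀, hS₀, hMS⟩ := hmax M hM h2.1 hsM h2.ne
        exact hcov Ψ hcΨ S₀ hS₀ (h1.1.trans hMS)
      · rcases hΨs.eq_or_ssubset with e | h
        · exact h1.not_subset (by rwa [← e] at hMs)
        · exact hc _ hJ h ((hle M h2.1).ssubset_of_ne hsM)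
    · obtain ⟨h1, h2, h3⟩ := hS L hLS
      refine ⟨h1, hFJ Θ hΘ subset_rfl, h2, fun M hM h4 h5 => ?_⟩
      have hsM : s M = Θ := (hle M h5.1).antisymm (h3 ▸ hs h4.1)
      obtain ⟨S₀, hS₀, hMS⟩ := hmax M hM h5.1 hsM h5.ne
      have e := hanti L hLS S₀ hS₀ (h4.1.trans hMS)
      exact h4.not_subset (e ▸ hMS)

theorem isLowerCover_nonempty_iff {α : Type*} {𝓛 : Set (Set α)} {L K : Set α} :
    IsLowerCover {Ψ ∈ 𝓛 | Ψ.Nonempty} L K ↔ L.Nonempty ∧ IsLowerCover 𝓛 L K := by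
  simp only [isLowerCover_iff, Set.mem_ofPred_eq]
  constructor
  · rintro ⟨⟨h1, h2⟩, ⟨h3, -⟩, h4, h5⟩
    exact ⟨h2, h1, h3, h4, fun M hM h6 => h5 M ⟨hM, h2.mono h6.1⟩ h6⟩
  · rintro ⟨h2, h1, h3, h4, h5⟩
    exact ⟨⟨h1, h2⟩, ⟨h3, h2.mono h4.1⟩, h4, fun M hM h6 => h5 M hM.1 h6⟩

/-! ### Witnesses that distinguish the classes -/

/-- A ternary function in `T₀₁` below a projection that is not monotone. -/
def nonMonoFun : BoolFun := ⟨3, fun a => a 1 && (a 0 == a 2)⟩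

/-- The constant `0` function of one variable. -/
def zeroFun : BoolFun := ⟨1, fun _ => false⟩

theorem nonMonoFun_mem (hx : idFun ∈ Ψ) : nonMonoFun ∈ clUT k Ψ ∩ clOI :=
  ⟨mem_clUT_of_le_minor hx (fun _ => 1) fun _ ha => (Bool.and_eq_true_iff.1 ha).1,
    mem_clOI.2 ⟨rfl, rfl⟩⟩

theorem nonMonoFun_notMem_clM : nonMonoFun ∉ clM := by
  intro h
  have h1 : (fun i : Fin (3 : ℕ+) => decide (i = 1)) ≤ fun i => decide (i ≠ 0) := by
    intro i
    refine bool_le_iff.2 fun hi => ?_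
    rw [of_decide_eq_true hi]
    rfl
  exact absurd (mem_clM.1 h _ _ h1 rfl) (by decide)

theorem zeroFun_mem_constZero : zeroFun ∈ constZero := fun _ => rfl

theorem zeroFun_notMem_clOI : zeroFun ∉ clOI := fun h => absurd (mem_clOI.1 h).2 (by decide)

theorem idFun_mem_clM01 : idFun ∈ clM01 :=
  clM01_eq ▸ ⟨mem_clM.2 fun _ _ hab => bool_le_iff.1 (hab 0), mem_clOI.2 ⟨rfl, rfl⟩⟩

theorem constZero_subset_clM0 : constZero ⊆ clM0 := fun f hf =>
  ⟨fun a b _ => by rw [hf a]; exact Bool.false_le _, hf _⟩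

theorem constZero_subset_clUT (h : Θ.Nonempty) : constZero ⊆ clUT k Θ := by
  rintro ⟨n, f⟩ hf
  obtain ⟨⟨m, θ⟩, hθ⟩ := h
  exact mem_clUT_of_le_minor hθ (fun _ => 0) fun a ha => absurd (ha.symm.trans (hf a)) (by simp)

theorem clM01_subset_clM : clM01 ⊆ clM := clM01_eq ▸ Set.inter_subset_left

theorem clM01_subset_clOI : clM01 ⊆ clOI := clM01_eq ▸ Set.inter_subset_right

theorem clM01_subset_clM0 : clM01 ⊆ clM0 := fun _ h => h.1

theorem clM0_subset_clOI_union : clM0 ⊆ clOI ∪ constZero :=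
  clM0_subset.trans (Set.union_subset_union_left _ clM01_subset_clOI)

theorem subset_clM0 (hX : K ⊆ clOI ∪ constZero) (hM : K ⊆ clM) : K ⊆ clM0 := fun _ hf =>
  ⟨hM hf, (hX hf).elim (fun h => h.1.2) fun h => h _⟩

theorem constZero_subset_of_not_subset_clOI (hK : classComp K clProj ⊆ K)
    (hX : K ⊆ clOI ∪ constZero) (h : ¬ K ⊆ clOI) : constZero ⊆ K := by
  obtain ⟨⟨n, f⟩, hf, hf'⟩ := Set.not_subset.1 h
  have hf0 := (hX hf).resolve_left hf'
  exact constZero_subset_of_apply hK hf (hf0 _) (hf0 _)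

theorem idFun_mem_of_mem_clOI (hK : classComp K clProj ⊆ K) {f : BoolFun} (hf : f ∈ K)
    (h : f ∈ clOI) : idFun ∈ K :=
  idFun_mem_of_apply hK hf (mem_clOI.1 h).1 (mem_clOI.1 h).2

theorem clUT_inter_mono : Monotone fun Ψ => clUT k Ψ ∩ X := fun _ _ h =>
  Set.inter_subset_inter_left _ (clUT_mono h)

theorem ssubset_of_mem_of_notMem {α : Type*} {A B : Set α} (h : A ⊆ B) {x : α} (hx : x ∈ B)
    (hx' : x ∉ A) : A ⊂ B := h.ssubset_of_ne fun e => hx' (e ▸ hx)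

theorem idFun_mem_of_shadow_eq (hk : 2 ≤ k) (hΘ : Θ ∈ ideals MinMin k) (h1 : oneFun ∉ Θ)
    (hx : idFun ∈ Θ) (hL : classComp L clProj ⊆ L) (hLΘ : L ⊆ clUT k Θ)
    (hs : shadow k L = Θ) : idFun ∈ L :=
  (idFun_mem_iff_mem_shadow hk hL (oneFun_notMem_of_subset_clUT hk hΘ h1 hLΘ)).1 (hs ▸ hx)

/-! ### Classes of functions preserving the constants -/

theorem hasLowerCovers_clOI_union (hk : 2 ≤ k) (hΘ : Θ ∈ ideals (MinMinC clXI) k)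
    (h1 : oneFun ∉ Θ) (hne : Θ.Nonempty) :
    HasLowerCovers (clonoids clProj (clMU01 k)) (clUT k Θ ∩ (clOI ∪ constZero))
      ({L | ∃ Ψ, Ψ.Nonempty ∧ IsLowerCover (ideals (MinMinC clXI) k) Ψ Θ ∧
          L = clUT k Ψ ∩ (clOI ∪ constZero)} ∪
        {clUT k Θ ∩ clOI} ∪
        {L | Θ ∈ ideals (MinMinC clM) k ∧ L = clUT k Θ ∩ clM0}) := by
  have hΘ' := ideals_minMinC_subset hΘ
  have hx := idFun_mem_of_mem_ideals_clXI hk hΘ hne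
  have hzero : ∀ {Ψ : Set BoolFun}, Ψ.Nonempty → zeroFun ∈ clUT k Ψ := fun h =>
    constZero_subset_clUT h zeroFun_mem_constZero
  have hM0 : clUT k Θ ∩ clM0 ⊂ clUT k Θ ∩ (clOI ∪ constZero) :=
    ssubset_of_mem_of_notMem (Set.inter_subset_inter_right _ clM0_subset_clOI_union)
      ⟨(nonMonoFun_mem hx).1, Or.inl (nonMonoFun_mem (k := k) hx).2⟩
      fun h => nonMonoFun_notMem_clM h.2.1
  simp only [Set.union_assoc, ← and_assoc, ← isLowerCover_nonempty_iff]
  refine hasLowerCovers_of_embedding (F := fun Ψ => clUT k Ψ ∩ (clOI ∪ constZero))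
    (s := shadow k) clUT_inter_mono (fun _ _ => shadow_mono) ⟨hΘ, hne⟩ ?_ ?_ ?_ ?_ ?_ ?_ ?_
  · exact fun _ _ _ => inter_mem_clonoids clUT_mem_clonoids clOI_union_constZero_mem_clonoids
  · exact fun Ψ hΨ hle => shadow_clUT_inter_clOI_union hk hΨ.1 fun h => h1 (hle h)
  · intro L hL hLΘ
    have hLX := hLΘ.trans Set.inter_subset_right
    by_cases hxL : idFun ∈ L
    · exact Or.inl ⟨⟨shadow_mem_ideals_clXI hL.1 hxL hLX,
        idFun, idFun_mem_atMost hk, _, hxL, fun _ h => h⟩,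
        Set.subset_inter subset_clUT_shadow hLX⟩
    -- otherwise `L ⊆ C₀`, and `L` is strictly below `U^k(Θ) ∩ M₀`
    · have hL0 : L ⊆ constZero := fun f hf =>
        (hLX hf).resolve_left fun h => hxL (idFun_mem_of_mem_clOI hL.1 hf h)
      refine Or.inr ⟨⟨_, inter_mem_clonoids clUT_mem_clonoids clM0_mem_clonoids, ?_, hM0⟩, ?_⟩
      · exact ssubset_of_mem_of_notMem (Set.subset_inter (hLΘ.trans Set.inter_subset_left)
          (hL0.trans constZero_subset_clM0))
          ⟨subset_clUT hx, clM01_subset_clM0 idFun_mem_clM01⟩ hxL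
      · intro Ψ hΨ _ hle
        exact hxL (hle ⟨subset_clUT (idFun_mem_of_mem_ideals_clXI hk hΨ.1 hΨ.2),
          Or.inl (clM01_subset_clOI idFun_mem_clM01)⟩)
  · intro L hL hLΘ hs hLne
    have hLU := hLΘ.trans Set.inter_subset_left
    have hLX := hLΘ.trans Set.inter_subset_right
    have hxL := idFun_mem_of_shadow_eq hk hΘ' h1 hx hL.1 hLU hs
    by_cases hM : L ⊆ clM
    · exact ⟨_, Or.inr ⟨hs ▸ shadow_mem_ideals_of_subset hL.1 hM, rfl⟩,
        Set.subset_inter hLU (subset_clM0 hLX hM)⟩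
    · refine ⟨_, Or.inl rfl, Set.subset_inter hLU ?_⟩
      by_contra hOI
      refine hLne (hLΘ.antisymm ?_)
      rintro f ⟨hf, hf' | hf'⟩
      · exact clUT_shadow_inter_clOI_subset hk hL hxL hLX hM ⟨hs.symm ▸ hf, hf'⟩
      · exact constZero_subset_of_not_subset_clOI hL.1 hLX hOI hf'
  · rintro S₀ (rfl | ⟨hΘM, rfl⟩)
    · exact ⟨inter_mem_clonoids clUT_mem_clonoids clOI_mem_clonoids,
        ssubset_of_mem_of_notMem (Set.inter_subset_inter_right _ Set.subset_union_left)
          ⟨hzero hne, Or.inr zeroFun_mem_constZero⟩ fun h => zeroFun_notMem_clOI h.2,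
        shadow_clUT_inter_clOI hk hΘ h1⟩
    · exact ⟨inter_mem_clonoids clUT_mem_clonoids clM0_mem_clonoids, hM0,
        shadow_clUT_inter_clM0 hk hΘM h1⟩
  · rintro S₀ (rfl | ⟨-, rfl⟩) S₁ (rfl | ⟨-, rfl⟩) h
    · rfl
    · exact absurd (h (nonMonoFun_mem hx)).2.1 nonMonoFun_notMem_clM
    · exact absurd (h ⟨hzero hne, constZero_subset_clM0 zeroFun_mem_constZero⟩).2
        zeroFun_notMem_clOI
    · rfl
  · intro Ψ hΨ S₀ hS₀ hle
    obtain ⟨hΨ, -⟩ := isLowerCover_iff.1 hΨ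
    have hxΨ := idFun_mem_of_mem_ideals_clXI hk hΨ.1 hΨ.2
    rcases hS₀ with rfl | ⟨-, rfl⟩
    · exact zeroFun_notMem_clOI (hle ⟨hzero hΨ.2, Or.inr zeroFun_mem_constZero⟩).2
    · exact nonMonoFun_notMem_clM
        (hle ⟨(nonMonoFun_mem hxΨ).1, Or.inl (nonMonoFun_mem (k := k) hxΨ).2⟩).2.1

theorem hasLowerCovers_clOI (hk : 2 ≤ k) (hΘ : Θ ∈ ideals (MinMinC clXI) k)
    (h1 : oneFun ∉ Θ) (hne : Θ.Nonempty) :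
    HasLowerCovers (clonoids clProj (clMU01 k)) (clUT k Θ ∩ clOI)
      ({L | ∃ Ψ, Ψ.Nonempty ∧ IsLowerCover (ideals (MinMinC clXI) k) Ψ Θ ∧
          L = clUT k Ψ ∩ clOI} ∪
        {L | Θ ∈ ideals (MinMinC clM) k ∧ L = clUT k Θ ∩ clM01}) := by
  have hΘ' := ideals_minMinC_subset hΘ
  have hx := idFun_mem_of_mem_ideals_clXI hk hΘ hne
  have hM01 : clUT k Θ ∩ clM01 ⊂ clUT k Θ ∩ clOI :=
    ssubset_of_mem_of_notMem (Set.inter_subset_inter_right _ clM01_subset_clOI)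
      (nonMonoFun_mem hx) fun h => nonMonoFun_notMem_clM (clM01_subset_clM h.2)
  simp only [← and_assoc, ← isLowerCover_nonempty_iff]
  refine hasLowerCovers_of_embedding (F := fun Ψ => clUT k Ψ ∩ clOI)
    (s := shadow k) clUT_inter_mono (fun _ _ => shadow_mono) ⟨hΘ, hne⟩ ?_ ?_ ?_ ?_ ?_ ?_ ?_
  · exact fun _ _ _ => inter_mem_clonoids clUT_mem_clonoids clOI_mem_clonoids
  · exact fun Ψ hΨ hle => shadow_clUT_inter_clOI hk hΨ.1 fun h => h1 (hle h)
  · intro L hL hLΘ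
    have hLX := hLΘ.trans Set.inter_subset_right
    by_cases hxL : idFun ∈ L
    · exact Or.inl ⟨⟨shadow_mem_ideals_clXI hL.1 hxL (hLX.trans Set.subset_union_left),
        idFun, idFun_mem_atMost hk, _, hxL, fun _ h => h⟩,
        Set.subset_inter subset_clUT_shadow hLX⟩
    -- otherwise `L` is empty, and strictly below `U^k(Θ) ∩ M₀₁`
    · have hL0 : L ⊆ ∅ := fun f hf => hxL (idFun_mem_of_mem_clOI hL.1 hf (hLX hf))
      refine Or.inr ⟨⟨_, inter_mem_clonoids clUT_mem_clonoids clM01_mem_clonoids, ?_, hM01⟩, ?_⟩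
      · exact ssubset_of_mem_of_notMem (hL0.trans (Set.empty_subset _))
          ⟨subset_clUT hx, idFun_mem_clM01⟩ hxL
      · intro Ψ hΨ _ hle
        exact hxL (hle ⟨subset_clUT (idFun_mem_of_mem_ideals_clXI hk hΨ.1 hΨ.2),
          clM01_subset_clOI idFun_mem_clM01⟩)
  · intro L hL hLΘ hs hLne
    have hLU := hLΘ.trans Set.inter_subset_left
    have hLX := hLΘ.trans Set.inter_subset_right
    have hxL := idFun_mem_of_shadow_eq hk hΘ' h1 hx hL.1 hLU hs
    have hM : L ⊆ clM := by
      by_contra hM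
      refine hLne (hLΘ.antisymm ?_)
      have := clUT_shadow_inter_clOI_subset hk hL hxL (hLX.trans Set.subset_union_left) hM
      rwa [hs] at this
    exact ⟨_, ⟨hs ▸ shadow_mem_ideals_of_subset hL.1 hM, rfl⟩,
      Set.subset_inter hLU (clM01_eq ▸ Set.subset_inter hM hLX)⟩
  · rintro S₀ ⟨hΘM, rfl⟩
    exact ⟨inter_mem_clonoids clUT_mem_clonoids clM01_mem_clonoids, hM01,
        shadow_clUT_inter_clM01 hk hΘM h1 hx⟩
  · rintro S₀ ⟨-, rfl⟩ S₁ ⟨-, rfl⟩ _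
    rfl
  · rintro Ψ hΨ S₀ ⟨-, rfl⟩ hle
    obtain ⟨hΨ, -⟩ := isLowerCover_iff.1 hΨ
    have hxΨ := idFun_mem_of_mem_ideals_clXI hk hΨ.1 hΨ.2
    exact nonMonoFun_notMem_clM (clM01_subset_clM (hle (nonMonoFun_mem hxΨ)).2)

/-! ### Classes of monotone functions -/

theorem constZero_mem_ideals_clM : constZero ∈ ideals (MinMinC clM) k := by
  rw [← Set.inter_eq_right.2 (constZero_subset_atMost (k := k))]
  refine inter_atMost_mem_ideals ?_
  rintro f g (h | ⟨σ, h⟩ | ⟨⟨-, hl⟩⟩) hg a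
  · cases h with | intro h =>
    exact Bool.eq_false_iff.2 fun ha =>
      absurd ((bool_le_iff.1 (h a) ha).symm.trans (hg a)) (by simp)
  · rw [h]
    exact hg _
  · exact Bool.eq_false_iff.2 fun ha => absurd
      ((bool_le_iff.1 (hl ⟨fun _ => le_rfl, (constZero_subset_clM0 hg).1⟩ a) ha).symm.trans (hg a))
      (by simp)

/-- The ideal `C₀` lies strictly between the empty ideal and `Θ`. -/
theorem nonempty_of_isLowerCover_clM (hΘ : Θ ∈ ideals (MinMinC clM) k) (hne : Θ.Nonempty)
    (hzero : Θ ≠ constZero) (h : IsLowerCover (ideals (MinMinC clM) k) Ψ Θ) : Ψ.Nonempty := by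
  obtain ⟨-, -, -, hc⟩ := isLowerCover_iff.1 h
  by_contra hΨ
  rw [Set.not_nonempty_iff_eq_empty] at hΨ
  refine hc _ constZero_mem_ideals_clM ?_
    ((constZero_subset (ideals_minMinC_subset hΘ) hne).ssubset_of_ne hzero.symm)
  rw [hΨ]
  exact Set.empty_ssubset.2 ⟨_, zeroFun_mem_constZero⟩

theorem hasLowerCovers_clM0 (hk : 2 ≤ k) (hΘ : Θ ∈ ideals (MinMinC clM) k)
    (h1 : oneFun ∉ Θ) (hne : Θ.Nonempty) (hΘ0 : Θ ≠ constZero) :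
    HasLowerCovers (clonoids clProj (clMU01 k)) (clUT k Θ ∩ clM0)
      ({L | ∃ Ψ, IsLowerCover (ideals (MinMinC clM) k) Ψ Θ ∧ L = clUT k Ψ ∩ clM0} ∪
        {clUT k Θ ∩ clM01}) := by
  have hΘ' := ideals_minMinC_subset hΘ
  obtain ⟨n, θ, a, hθ, hθa⟩ := exists_true_point hΘ' hΘ0 hne
  have hx := idFun_mem_of_mem_ideals_clM hk hΘ h1 hθ hθa
  have hzero : ∀ {Ψ : Set BoolFun}, Ψ.Nonempty → zeroFun ∈ clUT k Ψ ∩ clM0 := fun h =>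
    ⟨constZero_subset_clUT h zeroFun_mem_constZero, constZero_subset_clM0 zeroFun_mem_constZero⟩
  have hz : zeroFun ∉ clM01 := fun h => zeroFun_notMem_clOI (clM01_subset_clOI h)
  refine hasLowerCovers_of_embedding (F := fun Ψ => clUT k Ψ ∩ clM0)
    (s := shadow k) clUT_inter_mono (fun _ _ => shadow_mono) hΘ ?_ ?_ ?_ ?_ ?_ ?_ ?_
  · exact fun _ _ _ => inter_mem_clonoids clUT_mem_clonoids clM0_mem_clonoids
  · exact fun Ψ hΨ hle => shadow_clUT_inter_clM0 hk hΨ fun h => h1 (hle h)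
  · intro L hL hLΘ
    have hLX := hLΘ.trans Set.inter_subset_right
    exact Or.inl ⟨shadow_mem_ideals_of_subset hL.1 fun f hf => (hLX hf).1,
      Set.subset_inter subset_clUT_shadow hLX⟩
  · intro L hL hLΘ hs hLne
    have hLU := hLΘ.trans Set.inter_subset_left
    have hLX := hLΘ.trans Set.inter_subset_right
    have hxL := idFun_mem_of_shadow_eq hk hΘ' h1 hx hL.1 hLU hs
    refine ⟨_, rfl, Set.subset_inter hLU (clM01_eq ▸ Set.subset_inter (fun f hf => (hLX hf).1) ?_)⟩
    by_contra hOI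
    refine hLne (hLΘ.antisymm ?_)
    have := clUT_shadow_inter_clM0_subset hk hL hxL
      (constZero_subset_of_not_subset_clOI hL.1 (hLX.trans clM0_subset_clOI_union) hOI)
    rwa [hs] at this
  · rintro S₀ rfl
    exact ⟨inter_mem_clonoids clUT_mem_clonoids clM01_mem_clonoids,
      ssubset_of_mem_of_notMem (Set.inter_subset_inter_right _ clM01_subset_clM0)
        (hzero hne) fun h => hz h.2, shadow_clUT_inter_clM01 hk hΘ h1 hx⟩
  · rintro S₀ rfl S₁ rfl _
    rfl
  · rintro Ψ hΨ S₀ rfl hle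
    exact hz (hle (hzero (nonempty_of_isLowerCover_clM hΘ hne hΘ0 hΨ))).2

theorem hasLowerCovers_clM01 (hk : 2 ≤ k) (hΘ : Θ ∈ ideals (MinMinC clM) k)
    (h1 : oneFun ∉ Θ) (hne : Θ.Nonempty) (hΘ0 : Θ ≠ constZero) :
    HasLowerCovers (clonoids clProj (clMU01 k)) (clUT k Θ ∩ clM01)
      {L | ∃ Ψ, IsLowerCover (ideals (MinMinC clM) k) Ψ Θ ∧ L = clUT k Ψ ∩ clM01} := by
  have hΘ' := ideals_minMinC_subset hΘ
  obtain ⟨n, θ, a, hθ, hθa⟩ := exists_true_point hΘ' hΘ0 hne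
  have hx := idFun_mem_of_mem_ideals_clM hk hΘ h1 hθ hθa
  have hz : Disjoint clM01 constZero := Set.disjoint_left.2 fun f hf hf0 =>
    absurd ((clM01_subset_clOI hf).2.2.symm.trans (hf0 _)) (by simp)
  have hcov : ∀ Ψ, IsLowerCover {Ψ ∈ ideals (MinMinC clM) k | Ψ.Nonempty} Ψ Θ ↔
      IsLowerCover (ideals (MinMinC clM) k) Ψ Θ := fun Ψ =>
    isLowerCover_nonempty_iff.trans
      (and_iff_right_of_imp (nonempty_of_isLowerCover_clM hΘ hne hΘ0))
  -- for nonempty `L ⊆ M₀₁` the shadow already contains the constants `0`;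
  -- adding them pairs the empty class with the ideal `C₀`
  have hs : ∀ Ψ ∈ {Ψ ∈ ideals (MinMinC clM) k | Ψ.Nonempty}, Ψ ⊆ Θ →
      shadow k (clUT k Ψ ∩ clM01) ∪ constZero = Ψ := by
    rintro Ψ ⟨hΨ, hΨne⟩ hle
    have h0 := constZero_subset (ideals_minMinC_subset hΨ) hΨne
    refine (Set.union_subset
      (shadow_clUT_inter_subset (ideals_minMinC_subset hΨ)) h0).antisymm ?_
    by_cases hΨ0 : Ψ = constZero
    · conv_lhs => rw [hΨ0]
      exact Set.subset_union_right
    obtain ⟨n, θ, a, hθ, hθa⟩ := exists_true_point (ideals_minMinC_subset hΨ) hΨ0 hΨne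
    have h1Ψ : oneFun ∉ Ψ := fun h => h1 (hle h)
    have hxΨ := idFun_mem_of_mem_ideals_clM hk hΨ h1Ψ hθ hθa
    rw [shadow_clUT_inter_clM01 hk hΨ h1Ψ hxΨ]
    exact Set.subset_union_left
  rw [← Set.union_empty {L | _}]
  simp only [← hcov]
  refine hasLowerCovers_of_embedding (F := fun Ψ => clUT k Ψ ∩ clM01)
    (s := fun L => shadow k L ∪ constZero) clUT_inter_mono
    (fun _ _ h => Set.union_subset_union_left _ (shadow_mono h)) ⟨hΘ, hne⟩ ?_ hs ?_ ?_
    (by simp) (by simp) (by simp)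
  · exact fun _ _ _ => inter_mem_clonoids clUT_mem_clonoids clM01_mem_clonoids
  · intro L hL hLΘ
    have hLX := hLΘ.trans Set.inter_subset_right
    refine Or.inl ⟨⟨?_, zeroFun, Or.inr zeroFun_mem_constZero⟩, Set.subset_inter
      (subset_clUT_shadow.trans (clUT_mono Set.subset_union_left)) hLX⟩
    have hI : shadow k L ∈ ideals (MinMinC clM) k :=
      shadow_mem_ideals_of_subset hL.1 (hLX.trans clM01_subset_clM)
    rcases (shadow k L).eq_empty_or_nonempty with he | he
    · rw [he, Set.empty_union]
      exact constZero_mem_ideals_clM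
    · rwa [Set.union_eq_left.2 (constZero_subset (ideals_minMinC_subset hI) he)]
  · intro L hL hLΘ hsL hLne
    have hLU := hLΘ.trans Set.inter_subset_left
    have hxs : idFun ∈ shadow k L := by
      have : idFun ∈ shadow k L ∪ constZero := by
        change shadow k L ∪ constZero = Θ at hsL
        exact hsL ▸ hx
      exact this.resolve_right fun h => Set.disjoint_left.1 hz idFun_mem_clM01 h
    have h0 := constZero_subset (shadow_mem_ideals hL.1) ⟨_, hxs⟩
    have hsL : shadow k L = Θ := (Set.union_eq_left.2 h0).symm.trans hsL
    have hxL := idFun_mem_of_shadow_eq hk hΘ' h1 hx hL.1 hLU hsL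
    refine absurd (hLΘ.antisymm ?_) hLne
    have := clUT_shadow_inter_clM01_subset hk hL hxL
    rwa [hsL] at this

/-! ### Classes of reflexive functions -/

theorem hasLowerCovers_clR00 (hk : 2 ≤ k) (hΘ : Θ ∈ ideals (MinMinC clR) k)
    (h1 : oneFun ∉ Θ) :
    HasLowerCovers (clonoids clProj (clMU01 k)) (clUT k Θ ∩ clR00)
      {L | ∃ Ψ, IsLowerCover (ideals (MinMinC clR) k) Ψ Θ ∧ L = clUT k Ψ ∩ clR00} := by
  have hR : clR00 ⊆ clR := fun _ h => h.1.1
  rw [← Set.union_empty {L | _}]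
  refine hasLowerCovers_of_embedding (F := fun Ψ => clUT k Ψ ∩ clR00)
    (s := shadow k) clUT_inter_mono (fun _ _ => shadow_mono) hΘ ?_ ?_ ?_ ?_
    (by simp) (by simp) (by simp)
  · exact fun _ _ _ => inter_mem_clonoids clUT_mem_clonoids clR00_mem_clonoids
  · exact fun Ψ hΨ hle => shadow_clUT_inter_clR00 hk hΨ fun h => h1 (hle h)
  · intro L hL hLΘ
    have hLX := hLΘ.trans Set.inter_subset_right
    exact Or.inl ⟨shadow_mem_ideals_of_subset hL.1 (hLX.trans hR),
      Set.subset_inter subset_clUT_shadow hLX⟩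
  · intro L hL hLΘ hs hLne
    have hLX := hLΘ.trans Set.inter_subset_right
    refine absurd (hLΘ.antisymm ?_) hLne
    have := clUT_shadow_inter_clR_subset hk hL fun f hf => (clR00_eq ▸ hLX hf).2
    rw [hs] at this
    exact (Set.inter_subset_inter_right _ hR).trans this

/-! ### Inner negation -/

/-- The inner negation of `f`, the function `a ↦ f(ā)`. -/
def innerNeg (f : BoolFun) : BoolFun := ⟨f.1, fun a => f.2 fun i => !(a i)⟩

/-- The class of the inner negations of the members of `K`, described as a preimage, which makes
no difference because inner negation is an involution. -/
def innerClass (K : Set BoolFun) : Set BoolFun := {f | innerNeg f ∈ K}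

theorem innerNeg_innerNeg (f : BoolFun) : innerNeg (innerNeg f) = f := by
  obtain ⟨n, f⟩ := f
  simp [innerNeg]

theorem innerClass_innerClass (K : Set BoolFun) : innerClass (innerClass K) = K := by
  ext f
  change innerNeg (innerNeg f) ∈ K ↔ _
  rw [innerNeg_innerNeg]

theorem innerClass_involutive : Function.Involutive innerClass := innerClass_innerClass

theorem innerClass_mono (h : K ⊆ L) : innerClass K ⊆ innerClass L := fun _ hf => h hf

theorem innerClass_subset_iff : innerClass K ⊆ innerClass L ↔ K ⊆ L :=
  ⟨fun h => by simpa [innerClass_innerClass] using innerClass_mono h, innerClass_mono⟩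

theorem innerClass_subset_comm : innerClass K ⊆ L ↔ K ⊆ innerClass L := by
  rw [← innerClass_subset_iff, innerClass_innerClass]

theorem innerClass_ssubset_iff : innerClass K ⊂ innerClass L ↔ K ⊂ L := by
  simp only [ssubset_iff_subset_not_subset, innerClass_subset_iff]

theorem innerClass_inter : innerClass (K ∩ L) = innerClass K ∩ innerClass L := rfl

theorem innerClass_union : innerClass (K ∪ L) = innerClass K ∪ innerClass L := rfl

theorem innerClass_nonempty_iff : (innerClass K).Nonempty ↔ K.Nonempty :=
  ⟨fun ⟨_, h⟩ => ⟨_, h⟩, fun ⟨f, h⟩ => ⟨innerNeg f, by rwa [← innerClass_innerClass K] at h⟩⟩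

theorem innerClass_mem_clonoids (hK : K ∈ clonoids clProj C) :
    innerClass K ∈ clonoids clProj C := by
  refine ⟨?_, ?_⟩
  · rintro _ ⟨n, m, f, g, hf, hg, rfl⟩
    choose σ hσ using hg
    have e : g = fun i a => a (σ i) := funext hσ
    rw [e]
    exact minor_mem hK.1 hf σ
  · rintro _ ⟨n, m, f, g, hf, hg, rfl⟩
    exact hK.2 ⟨n, m, f, fun i a => g i fun p => !(a p), hf, hg, rfl⟩

theorem innerClass_clUT_subset : innerClass (clUT k Θ) ⊆ clUT k (innerClass Θ) := by
  classical
  intro f hf T hT hT'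
  obtain ⟨θ, hθ, τ, h⟩ := hf (T.image fun a i => !(a i)) (Finset.card_image_le.trans hT) (by
    intro a ha
    obtain ⟨b, hb, rfl⟩ := Finset.mem_image.1 ha
    simpa [innerNeg] using hT' b hb)
  refine ⟨innerNeg θ, ?_, τ, fun a ha => h _ (Finset.mem_image_of_mem _ ha)⟩
  rwa [← innerClass_innerClass Θ] at hθ

theorem innerClass_clUT : innerClass (clUT k Θ) = clUT k (innerClass Θ) :=
  innerClass_clUT_subset.antisymm <| by
    rw [← innerClass_subset_comm]
    simpa [innerClass_innerClass] using innerClass_clUT_subset (k := k) (Θ := innerClass Θ)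

theorem innerNeg_mem_atMost {f : BoolFun} (hf : f ∈ atMost k) : innerNeg f ∈ atMost k := by
  classical
  obtain ⟨n, f⟩ := f
  obtain ⟨T, hT, hTf⟩ := exists_finset_of_atMost hf
  refine atMost_of_subset (T := T.image fun a i => !(a i)) (Finset.card_image_le.trans hT) ?_
  intro a ha
  exact Finset.mem_image.2 ⟨_, (hTf _).2 ha, by simp⟩

theorem innerClass_shadow_subset : innerClass (shadow k K) ⊆ shadow k (innerClass K) := by
  rintro f ⟨hf, g, hg, h⟩
  refine ⟨innerNeg_innerNeg f ▸ innerNeg_mem_atMost hf, fun a => g fun i => !(a i), ?_,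
    fun a ha => h _ ?_⟩
  · rw [← innerClass_innerClass K] at hg
    exact hg
  · simpa [innerNeg] using ha

theorem innerClass_shadow : innerClass (shadow k K) = shadow k (innerClass K) :=
  innerClass_shadow_subset.antisymm <| by
    rw [← innerClass_subset_comm]
    simpa [innerClass_innerClass] using innerClass_shadow_subset (k := k) (K := innerClass K)

theorem innerClass_mem_ideals {r s : BoolFun → BoolFun → Prop}
    (h : ∀ f g, r f g → s (innerNeg f) (innerNeg g)) (hΘ : Θ ∈ ideals (Relation.TransGen s) k) :
    innerClass Θ ∈ ideals (Relation.TransGen r) k := by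
  refine ⟨fun f hf => innerNeg_innerNeg f ▸ innerNeg_mem_atMost (hΘ.1 hf),
    fun φ hφ γ hγ hr => hΘ.2 _ hφ _ (innerNeg_mem_atMost hγ) ?_⟩
  exact Relation.TransGen.lift innerNeg h _ _ hr

theorem minorant_innerNeg {f g : BoolFun} (h : Minorant f g) :
    Minorant (innerNeg f) (innerNeg g) := by
  cases h with | intro h =>
  exact .intro fun a => h _

theorem minor_innerNeg {f g : BoolFun} : Minor f g → Minor (innerNeg f) (innerNeg g) := by
  rintro ⟨σ, h⟩
  refine ⟨σ, ?_⟩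
  simp only [innerNeg, h]
  rfl

theorem isClosureOf_innerNeg {f g : BoolFun} (h : IsClosureOf C f g) :
    IsClosureOf (innerClass C) (innerNeg f) (innerNeg g) := by
  obtain ⟨⟨⟨h1, h2⟩, h3⟩⟩ := h
  refine .intro ⟨⟨fun a => h1 _, ?_⟩, ?_⟩
  · rw [← innerClass_innerClass C] at h2
    exact h2
  · rintro u ⟨h4, h5⟩ a
    have := h3 ⟨fun b => by simpa using h4 fun i => !(b i), h5⟩ fun i => !(a i)
    simpa using this

theorem innerClass_mem_ideals_minMin (hΘ : Θ ∈ ideals MinMin k) :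
    innerClass Θ ∈ ideals MinMin k :=
  innerClass_mem_ideals (fun _ _ h => h.imp minorant_innerNeg minor_innerNeg) hΘ

theorem innerClass_mem_ideals_minMinC (hΘ : Θ ∈ ideals (MinMinC C) k) :
    innerClass Θ ∈ ideals (MinMinC (innerClass C)) k := by
  refine innerClass_mem_ideals (fun f g h => ?_) hΘ
  refine h.imp minorant_innerNeg (Or.imp minor_innerNeg fun h => ?_)
  simpa only [innerClass_innerClass] using isClosureOf_innerNeg h

theorem innerClass_mem_ideals_minMinC_iff :
    innerClass Θ ∈ ideals (MinMinC (innerClass C)) k ↔ Θ ∈ ideals (MinMinC C) k :=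
  ⟨fun h => by simpa only [innerClass_innerClass] using innerClass_mem_ideals_minMinC h,
    innerClass_mem_ideals_minMinC⟩

theorem isLowerCover_innerClass {𝓛 𝓜 : Set (Set BoolFun)}
    (h : ∀ M, innerClass M ∈ 𝓜 ↔ M ∈ 𝓛) :
    IsLowerCover 𝓜 (innerClass L) (innerClass K) ↔ IsLowerCover 𝓛 L K := by
  simp only [isLowerCover_iff, h, innerClass_ssubset_iff]
  refine and_congr_right' (and_congr_right' (and_congr_right' ?_))
  exact innerClass_involutive.surjective.forall.trans (by simp only [h, innerClass_ssubset_iff])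

theorem innerClass_mem_clonoids_iff :
    innerClass K ∈ clonoids clProj C ↔ K ∈ clonoids clProj C :=
  ⟨fun h => innerClass_innerClass K ▸ innerClass_mem_clonoids h, innerClass_mem_clonoids⟩

/-- Inner negation transports lower covers in the lattice of clonoids. -/
theorem hasLowerCovers_innerClass {S : Set (Set BoolFun)}
    (h : HasLowerCovers (clonoids clProj C) (innerClass K) S) :
    HasLowerCovers (clonoids clProj C) K {L | innerClass L ∈ S} :=
  ⟨innerClass_mem_clonoids_iff.1 h.1, fun _ =>
    (isLowerCover_innerClass fun _ => innerClass_mem_clonoids_iff).symm.trans (h.2 _)⟩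

theorem innerClass_constZero : innerClass constZero = constZero := by
  ext ⟨n, f⟩
  exact ⟨fun h a => by simpa [innerNeg] using h fun i => !(a i), fun h a => h _⟩

theorem innerClass_clIX : innerClass clIX = clXI := by
  ext ⟨n, f⟩
  simp [innerClass, innerNeg, clIX, clXI, valZero, valOne]

theorem innerClass_clIO : innerClass clIO = clOI := by
  ext ⟨n, f⟩
  simp [innerClass, innerNeg, clIO, clOI, val, valZero, valOne, and_comm]

theorem mem_negClass {n : ℕ+} {f : (Fin n → Bool) → Bool} :
    (⟨n, f⟩ : BoolFun) ∈ negClass C ↔ (⟨n, fun a => !(f a)⟩ : BoolFun) ∈ C := by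
  constructor
  · rintro ⟨⟨m, g⟩, hg, h⟩
    cases h
    simpa using hg
  · exact fun h => ⟨_, h, by simp⟩

theorem innerClass_negClass_clM : innerClass (negClass clM) = clM := by
  ext ⟨n, f⟩
  change (⟨n, fun a => f fun i => !(a i)⟩ : BoolFun) ∈ negClass clM ↔ _
  rw [mem_negClass, mem_clM, mem_clM]
  have hc : ∀ a b : Fin n → Bool, a ≤ b → (fun i => !(b i)) ≤ fun i => !(a i) :=
    fun a b hab i => by
      have := hab i
      revert this
      change a i ≤ b i → (!(b i)) ≤ !(a i)
      generalize a i = x, b i = y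
      decide +revert
  constructor
  · intro h a b hab ha
    have := h _ _ (hc a b hab)
    simp only [Bool.not_not] at this
    revert this
    rw [ha]
    cases f b <;> simp
  · intro h a b hab ha
    have := h _ _ (hc a b hab)
    revert this ha
    cases f (fun i => !(a i)) <;> cases f (fun i => !(b i)) <;> simp

theorem innerClass_negClass_clM1 : innerClass (negClass clM1) = clM0 := by
  ext ⟨n, f⟩
  have h := Set.ext_iff.1 innerClass_negClass_clM ⟨n, f⟩
  change (⟨n, fun a => f fun i => !(a i)⟩ : BoolFun) ∈ negClass clM ↔ _ at h
  change (⟨n, fun a => f fun i => !(a i)⟩ : BoolFun) ∈ negClass clM1 ↔ _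
  rw [mem_negClass] at h ⊢
  exact and_congr h (by simp)

theorem innerClass_negClass_clM01 : innerClass (negClass clM01) = clM01 := by
  ext ⟨n, f⟩
  have h := Set.ext_iff.1 innerClass_negClass_clM ⟨n, f⟩
  change (⟨n, fun a => f fun i => !(a i)⟩ : BoolFun) ∈ negClass clM ↔ _ at h
  change (⟨n, fun a => f fun i => !(a i)⟩ : BoolFun) ∈ negClass clM01 ↔ _
  rw [mem_negClass] at h ⊢
  simp only [clM01, val, valZero, valOne, Set.mem_inter_iff, Set.mem_ofPred_eq, h]
  simp
  tauto

theorem innerClass_mem_ideals_clXI :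
    innerClass Θ ∈ ideals (MinMinC clXI) k ↔ Θ ∈ ideals (MinMinC clIX) k := by
  rw [← innerClass_clIX, innerClass_mem_ideals_minMinC_iff]

theorem innerClass_mem_ideals_clM :
    innerClass Θ ∈ ideals (MinMinC clM) k ↔ Θ ∈ ideals (MinMinC (negClass clM)) k := by
  conv_lhs => rw [← innerClass_negClass_clM]
  rw [innerClass_mem_ideals_minMinC_iff]

theorem isLowerCover_innerClass_clXI :
    IsLowerCover (ideals (MinMinC clXI) k) (innerClass L) (innerClass K) ↔
      IsLowerCover (ideals (MinMinC clIX) k) L K :=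
  isLowerCover_innerClass fun _ => innerClass_mem_ideals_clXI

theorem isLowerCover_innerClass_clM :
    IsLowerCover (ideals (MinMinC clM) k) (innerClass L) (innerClass K) ↔
      IsLowerCover (ideals (MinMinC (negClass clM)) k) L K :=
  isLowerCover_innerClass fun _ => innerClass_mem_ideals_clM

theorem innerClass_clUT_inter_eq : clUT k (innerClass Θ) ∩ innerClass X =
    innerClass (clUT k Θ ∩ X) := by
  rw [innerClass_inter, innerClass_clUT]

theorem innerClass_clIO_union : innerClass (clIO ∪ constZero) = clOI ∪ constZero := by
  rw [innerClass_union, innerClass_clIO, innerClass_constZero]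

theorem hasLowerCovers_clIO_union (hk : 2 ≤ k) (hΘ : Θ ∈ ideals (MinMinC clIX) k)
    (h1 : oneFun ∉ Θ) (hne : Θ.Nonempty) :
    HasLowerCovers (clonoids clProj (clMU01 k)) (clUT k Θ ∩ (clIO ∪ constZero))
      ({L | ∃ Ψ, Ψ.Nonempty ∧ IsLowerCover (ideals (MinMinC clIX) k) Ψ Θ ∧
          L = clUT k Ψ ∩ (clIO ∪ constZero)} ∪
        {clUT k Θ ∩ clIO} ∪
        {L | Θ ∈ ideals (MinMinC (negClass clM)) k ∧ L = clUT k Θ ∩ negClass clM1}) := by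
  have h := hasLowerCovers_clOI_union hk (innerClass_mem_ideals_clXI.2 hΘ) h1
    (innerClass_nonempty_iff.2 hne)
  rw [← innerClass_clIO_union, ← innerClass_clIO, ← innerClass_negClass_clM1,
    innerClass_clUT_inter_eq] at h
  convert hasLowerCovers_innerClass h using 1
  ext L
  symm
  simp only [Set.mem_union, Set.mem_ofPred_eq, Set.mem_singleton_iff]
  rw [innerClass_involutive.surjective.exists]
  simp only [innerClass_clUT_inter_eq, innerClass_mem_ideals_clM,
    innerClass_involutive.injective.eq_iff, innerClass_nonempty_iff,
    isLowerCover_innerClass_clXI]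

theorem hasLowerCovers_clIO (hk : 2 ≤ k) (hΘ : Θ ∈ ideals (MinMinC clIX) k)
    (h1 : oneFun ∉ Θ) (hne : Θ.Nonempty) :
    HasLowerCovers (clonoids clProj (clMU01 k)) (clUT k Θ ∩ clIO)
      ({L | ∃ Ψ, Ψ.Nonempty ∧ IsLowerCover (ideals (MinMinC clIX) k) Ψ Θ ∧
          L = clUT k Ψ ∩ clIO} ∪
        {L | Θ ∈ ideals (MinMinC (negClass clM)) k ∧ L = clUT k Θ ∩ negClass clM01}) := by
  have h := hasLowerCovers_clOI hk (innerClass_mem_ideals_clXI.2 hΘ) h1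
    (innerClass_nonempty_iff.2 hne)
  rw [← innerClass_clIO, ← innerClass_negClass_clM01, innerClass_clUT_inter_eq] at h
  convert hasLowerCovers_innerClass h using 1
  ext L
  symm
  simp only [Set.mem_union, Set.mem_ofPred_eq]
  rw [innerClass_involutive.surjective.exists]
  simp only [innerClass_clUT_inter_eq, innerClass_mem_ideals_clM,
    innerClass_involutive.injective.eq_iff, innerClass_nonempty_iff,
    isLowerCover_innerClass_clXI]

theorem innerClass_ne_constZero (h : Θ ≠ constZero) : innerClass Θ ≠ constZero := fun e =>
  h (innerClass_involutive.injective (e.trans innerClass_constZero.symm))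

theorem hasLowerCovers_negClass_clM1 (hk : 2 ≤ k) (hΘ : Θ ∈ ideals (MinMinC (negClass clM)) k)
    (h1 : oneFun ∉ Θ) (hne : Θ.Nonempty) (hΘ0 : Θ ≠ constZero) :
    HasLowerCovers (clonoids clProj (clMU01 k)) (clUT k Θ ∩ negClass clM1)
      ({L | ∃ Ψ, IsLowerCover (ideals (MinMinC (negClass clM)) k) Ψ Θ ∧
          L = clUT k Ψ ∩ negClass clM1} ∪
        {clUT k Θ ∩ negClass clM01}) := by
  have h := hasLowerCovers_clM0 hk (innerClass_mem_ideals_clM.2 hΘ) h1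
    (innerClass_nonempty_iff.2 hne) (innerClass_ne_constZero hΘ0)
  rw [← innerClass_negClass_clM1, ← innerClass_negClass_clM01, innerClass_clUT_inter_eq] at h
  convert hasLowerCovers_innerClass h using 1
  ext L
  symm
  simp only [Set.mem_union, Set.mem_ofPred_eq, Set.mem_singleton_iff]
  rw [innerClass_involutive.surjective.exists]
  simp only [innerClass_clUT_inter_eq, innerClass_involutive.injective.eq_iff,
    isLowerCover_innerClass_clM]

theorem hasLowerCovers_negClass_clM01 (hk : 2 ≤ k)
    (hΘ : Θ ∈ ideals (MinMinC (negClass clM)) k)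
    (h1 : oneFun ∉ Θ) (hne : Θ.Nonempty) (hΘ0 : Θ ≠ constZero) :
    HasLowerCovers (clonoids clProj (clMU01 k)) (clUT k Θ ∩ negClass clM01)
      {L | ∃ Ψ, IsLowerCover (ideals (MinMinC (negClass clM)) k) Ψ Θ ∧
        L = clUT k Ψ ∩ negClass clM01} := by
  have h := hasLowerCovers_clM01 hk (innerClass_mem_ideals_clM.2 hΘ) h1
    (innerClass_nonempty_iff.2 hne) (innerClass_ne_constZero hΘ0)
  rw [← innerClass_negClass_clM01, innerClass_clUT_inter_eq] at h
  convert hasLowerCovers_innerClass h using 1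
  ext L
  symm
  simp only [Set.mem_ofPred_eq]
  rw [innerClass_involutive.surjective.exists]
  simp only [innerClass_clUT_inter_eq, innerClass_involutive.injective.eq_iff,
    isLowerCover_innerClass_clM]

/-! ### The classes `U^k(Θ)` -/

theorem ltFun_mem_atMost (hk : 2 ≤ k) : ltFun ∈ atMost k :=
  atMost_of_subset (T := {fun i => decide (i = 1)})
    ((Finset.card_singleton _).trans_le (by lia)) fun a ha => by
      have h := Bool.and_eq_true_iff.1 ha
      have h0 : a 0 = false := by simpa using h.1
      rw [Finset.mem_singleton]
      refine funext ((Fin.forall_fin_two (p := fun i => a i = decide (i = (1 : Fin 2)))).2 ?_)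
      exact ⟨h0, h.2⟩

theorem ltFun_apply_iff {b : Fin (2 : ℕ+) → Bool} :
    ltFun.2 b = true ↔ b 0 = false ∧ b 1 = true := by
  simp [ltFun]

/-- Every ideal that contains a function other than a constant `0` contains `¬ x ∧ y`. -/
theorem ltFun_mem (hk : 2 ≤ k) (hΘ : Θ ∈ ideals MinMin k) {n : ℕ+} {θ : (Fin n → Bool) → Bool}
    {a : Fin n → Bool} (hθ : (⟨n, θ⟩ : BoolFun) ∈ Θ) (ha : θ a = true) : ltFun ∈ Θ := by
  refine mem_of_le_minor hΘ hθ (fun p => if a p then 1 else 0) (ltFun_mem_atMost hk)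
    fun b hb => ?_
  obtain ⟨h0, h1⟩ := ltFun_apply_iff.1 hb
  convert ha using 2
  funext p
  change b (if a p = true then 1 else 0) = a p
  by_cases hp : a p = true
  · rw [if_pos hp, h1, hp]
  · rw [if_neg hp, h0, Bool.eq_false_iff.2 hp]

theorem ltFun_apply : ltFun.2 (fun i => decide (i = 1)) = true := rfl

theorem ltFun_notMem_clOI_union : ltFun ∉ clOI ∪ constZero := by
  rintro (h | h)
  · exact absurd (mem_clOI.1 h).2 (by decide)
  · exact absurd (ltFun_apply.symm.trans (h _)) (by simp)

theorem ltFun_notMem_clR : ltFun ∉ clR := fun h =>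
  absurd (ltFun_apply.symm.trans (h _)) (by decide)

/-- The functions with at most `k` true points below some `¬ xᵢ ∧ xⱼ`: the least ideal that
contains a function other than a constant `0`. -/
def ltIdeal (k : ℕ) : Set BoolFun :=
  atMost k ∩ {f | ∃ i j, ∀ a, f.2 a = true → a i = false ∧ a j = true}

theorem ltIdeal_mem_ideals : ltIdeal k ∈ ideals MinMin k := by
  refine inter_atMost_mem_ideals ?_
  rintro f g (h | ⟨σ, h⟩) ⟨i, j, hg⟩
  · cases h with | intro h =>
    exact ⟨i, j, fun a ha => hg a (bool_le_iff.1 (h a) ha)⟩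
  · exact ⟨σ i, σ j, fun a ha => hg _ (by rwa [h] at ha)⟩

theorem ltFun_mem_ltIdeal (hk : 2 ≤ k) : ltFun ∈ ltIdeal k :=
  ⟨ltFun_mem_atMost hk, 0, 1, fun _ h => ltFun_apply_iff.1 h⟩

theorem ltIdeal_subset (hΘ : Θ ∈ ideals MinMin k) (h : ltFun ∈ Θ) : ltIdeal k ⊆ Θ := by
  rintro ⟨n, f⟩ ⟨hf, i, j, hij⟩
  refine mem_of_le_minor hΘ h (fun p => if p = 0 then i else j) hf fun a ha => ?_
  exact ltFun_apply_iff.2 (hij a ha)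

theorem notMem_ltIdeal {f : BoolFun}
    (h : f.2 (fun _ => false) = true ∨ f.2 (fun _ => true) = true) : f ∉ ltIdeal k := by
  rintro ⟨-, i, j, hij⟩
  rcases h with h | h
  · exact absurd (hij _ h).2 (by simp)
  · exact absurd (hij _ h).1 (by simp)

/-- The sum of two variables modulo `2`. -/
def xorFun : BoolFun := ⟨2, fun a => a 0 != a 1⟩

theorem xorFun_mem (hk : 2 ≤ k) (hΘ : Θ ∈ ideals (MinMinC clR) k) (h : ltFun ∈ Θ) :
    xorFun ∈ Θ := by
  refine mem_of_le_closure hΘ h (isClosureOf_clR _)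
    (atMost_of_subset (T := {fun i => decide (i = 1), fun i => decide (i = 0)})
      (Finset.card_le_two.trans hk) fun a ha => ?_) fun a ha => ?_
  · have key : ∀ b : Fin 2 → Bool, (b 0 != b 1) = true →
        b = (fun i => decide (i = 1)) ∨ b = fun i => decide (i = 0) := by decide
    rw [Finset.mem_insert, Finset.mem_singleton]
    exact key a ha
  · have key : ∀ b : Fin 2 → Bool, (b 0 != b 1) = true →
        ((!(b 0) && b 1) || (!(!(b 0)) && !(b 1))) = true := by decide
    exact key a ha

theorem xorFun_notMem_ltIdeal : xorFun ∉ ltIdeal k := by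
  rintro ⟨-, i, j, hij⟩
  have h0 := hij (fun i => decide (i = 0)) rfl
  have h1 := hij (fun i => decide (i = 1)) rfl
  have key : ∀ i j : Fin 2, decide (i = 0) = false ∧ decide (j = 0) = true →
      ¬ (decide (i = 1) = false ∧ decide (j = 1) = true) := by decide
  exact key i j h0 h1

/-- A lower cover of an ideal strictly above `ltIdeal k` is not contained in `C₀`, since
`ltIdeal k` would lie in between. -/
theorem ltFun_mem_of_isLowerCover (hk : 2 ≤ k) (h : IsLowerCover (ideals MinMin k) Ψ Θ)
    (hlt : ltFun ∈ Θ) {θ : BoolFun} (hθ : θ ∈ Θ) (hθ' : θ ∉ ltIdeal k) : ltFun ∈ Ψ := by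
  obtain ⟨hΨ, hΘ, -, hc⟩ := isLowerCover_iff.1 h
  by_contra hltΨ
  have h0 : Ψ ⊆ constZero := fun f hf a => Bool.eq_false_iff.2 fun ha =>
    hltΨ (ltFun_mem hk hΨ hf ha)
  exact hc _ ltIdeal_mem_ideals
    (ssubset_of_mem_of_notMem
      (h0.trans (constZero_subset ltIdeal_mem_ideals ⟨_, ltFun_mem_ltIdeal hk⟩))
      (ltFun_mem_ltIdeal hk) hltΨ)
    (ssubset_of_mem_of_notMem (ltIdeal_subset hΘ hlt) hθ hθ')

/-- A clonoid containing the identity that shares its shadow `Θ` with the larger class `U^k(Θ)`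
lies in `T₀₁ ∪ C₀`. -/
theorem mem_ideals_clXI_of_shadow_eq (hk : 2 ≤ k) (hΘ : Θ ∈ ideals MinMin k) (h1 : oneFun ∉ Θ)
    (hL : L ∈ clonoids clProj (clMU01 k)) (hLΘ : L ⊆ clUT k Θ) (hs : shadow k L = Θ)
    (hne : L ≠ clUT k Θ) (hx : idFun ∈ L) :
    Θ ∈ ideals (MinMinC clXI) k ∧ L ⊆ clUT k Θ ∩ (clOI ∪ constZero) := by
  have hX : L ⊆ clOI ∪ constZero := by
    by_contra hX
    have := clUT_shadow_subset_of_idFun hk hL hx (oneFun_notMem_of_subset_clUT hk hΘ h1 hLΘ) hX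
    exact hne (hLΘ.antisymm (hs ▸ this))
  exact ⟨hs ▸ shadow_mem_ideals_clXI hL.1 hx hX, Set.subset_inter hLΘ hX⟩

theorem hasLowerCovers_clUT (hk : 2 ≤ k) (hΘ : Θ ∈ ideals MinMin k)
    (h1 : oneFun ∉ Θ) (hne : Θ.Nonempty) (hΘ0 : Θ ≠ constZero) :
    HasLowerCovers (clonoids clProj (clMU01 k)) (clUT k Θ)
      ({L | ∃ Ψ, IsLowerCover (ideals MinMin k) Ψ Θ ∧ L = clUT k Ψ} ∪
        {L | Θ ∈ ideals (MinMinC clXI) k ∧ L = clUT k Θ ∩ (clOI ∪ constZero)} ∪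
        {L | Θ ∈ ideals (MinMinC clIX) k ∧ L = clUT k Θ ∩ (clIO ∪ constZero)} ∪
        {L | Θ ∈ ideals (MinMinC clR) k ∧ L = clUT k Θ ∩ clR00}) := by
  obtain ⟨n, θ, a, hθ, hθa⟩ := exists_true_point hΘ hΘ0 hne
  have hlt := ltFun_mem hk hΘ hθ hθa
  have hXI : ∀ {Θ : Set BoolFun}, Θ ∈ ideals (MinMinC clXI) k → Θ.Nonempty → idFun ∈ Θ :=
    fun h => idFun_mem_of_mem_ideals_clXI hk h
  have hIX : Θ ∈ ideals (MinMinC clIX) k → innerNeg idFun ∈ Θ := fun h =>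
    hXI (innerClass_mem_ideals_clXI.2 h) (innerClass_nonempty_iff.2 hne)
  have hltX : ∀ Ψ, ltFun ∈ Ψ → ¬ clUT k Ψ ⊆ clOI ∪ constZero := fun Ψ h h' =>
    ltFun_notMem_clOI_union (h' (subset_clUT h))
  have hltO : ∀ Ψ, ltFun ∈ Ψ → Ψ ∈ ideals MinMin k → ¬ clUT k Ψ ⊆ clIO ∪ constZero := by
    intro Ψ h hΨ h'
    rw [← innerClass_subset_iff, innerClass_clUT, innerClass_clIO_union] at h'
    refine hltX _ ?_ h'
    exact ltFun_mem hk (innerClass_mem_ideals_minMin hΨ) (a := fun i => decide (i = 0))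
      (show innerNeg (innerNeg ltFun) ∈ Ψ from (innerNeg_innerNeg ltFun).symm ▸ h) rfl
  have hltR : ∀ Ψ, ltFun ∈ Ψ → ¬ clUT k Ψ ⊆ clR00 := fun Ψ h h' =>
    ltFun_notMem_clR (h' (subset_clUT h)).1.1
  have hst : ∀ X : Set BoolFun, ¬ clUT k Θ ⊆ X → clUT k Θ ∩ X ⊂ clUT k Θ := fun X h =>
    Set.inter_subset_left.ssubset_of_ne fun e => h (e ▸ Set.inter_subset_right)
  have hidO : idFun ∉ clIO ∪ constZero := by
    rintro (h | h)
    · exact absurd h.1.2 (by decide)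
    · exact absurd (h fun _ => true) (by decide)
  have hnotO : innerNeg idFun ∉ clOI ∪ constZero := by
    rintro (h | h)
    · exact absurd h.1.2 (by decide)
    · exact absurd (h fun _ => false) (by decide)
  simp only [Set.union_assoc]
  refine hasLowerCovers_of_embedding (F := clUT k) (s := shadow k) (fun _ _ => clUT_mono)
    (fun _ _ => shadow_mono) hΘ ?_ ?_ ?_ ?_ ?_ ?_ ?_
  · exact fun _ _ _ => clUT_mem_clonoids
  · exact fun Ψ hΨ _ => shadow_clUT hΨ
  · exact fun L hL _ => Or.inl ⟨shadow_mem_ideals hL.1, subset_clUT_shadow⟩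
  · intro L hL hLΘ hs hLne
    by_cases hx : idFun ∈ L
    · obtain ⟨h, h'⟩ := mem_ideals_clXI_of_shadow_eq hk hΘ h1 hL hLΘ hs hLne hx
      exact ⟨_, Or.inl ⟨h, rfl⟩, h'⟩
    -- a clonoid that contains the negation is turned into the previous case by inner negation
    by_cases hnx : innerNeg idFun ∈ L
    · obtain ⟨h, h'⟩ := mem_ideals_clXI_of_shadow_eq (Θ := innerClass Θ) (L := innerClass L) hk
        (innerClass_mem_ideals_minMin hΘ) h1 (innerClass_mem_clonoids hL)
        (innerClass_clUT ▸ innerClass_mono hLΘ) (by rw [← innerClass_shadow, hs])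
        (fun e => hLne (innerClass_involutive.injective (e.trans innerClass_clUT.symm))) hnx
      rw [← innerClass_clIO_union, innerClass_clUT_inter_eq, innerClass_subset_iff] at h'
      exact ⟨_, Or.inr (Or.inl ⟨innerClass_mem_ideals_clXI.1 h, rfl⟩), h'⟩
    have h1L := oneFun_notMem_of_subset_clUT hk hΘ h1 hLΘ
    have hval : L ⊆ val Set.univ false false := by
      rintro ⟨n, f⟩ hf
      have h01 : f (fun _ => false) = true → f (fun _ => true) ≠ true :=
        fun h h' => h1L (oneFun_mem_of_apply hL.1 hf h h')
      have h0 : f (fun _ => false) = false := Bool.eq_false_iff.2 fun h0 => by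
        refine hnx (idFun_mem_of_apply (K := innerClass L) (innerClass_mem_clonoids hL).1
          (u := fun a => f fun i => !(a i)) ?_ (by simpa using h01 h0) (by simpa using h0))
        rw [← innerClass_innerClass L] at hf
        exact hf
      have h1 : f (fun _ => true) = false := Bool.eq_false_iff.2 fun h1 =>
        hx (idFun_mem_of_apply hL.1 hf h0 h1)
      exact ⟨⟨trivial, h0⟩, trivial, h1⟩
    have hR : L ⊆ clR := by
      by_contra hR
      have := clUT_shadow_subset_of_not_subset_clR hk hL hval hR
      exact hLne (hLΘ.antisymm (hs ▸ this))
    exact ⟨_, Or.inr (Or.inr ⟨hs ▸ shadow_mem_ideals_of_subset hL.1 hR, rfl⟩),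
      Set.subset_inter hLΘ (clR00_eq ▸ Set.subset_inter hR hval)⟩
  · rintro S₀ (⟨h, rfl⟩ | ⟨h, rfl⟩ | ⟨h, rfl⟩)
    · exact ⟨inter_mem_clonoids clUT_mem_clonoids clOI_union_constZero_mem_clonoids,
        hst _ (hltX _ hlt), shadow_clUT_inter_clOI_union hk h h1⟩
    · refine ⟨innerClass_mem_clonoids_iff.1 ?_, hst _ (hltO _ hlt hΘ),
        innerClass_involutive.injective ?_⟩
      · rw [← innerClass_clUT_inter_eq, innerClass_clIO_union]
        exact inter_mem_clonoids clUT_mem_clonoids clOI_union_constZero_mem_clonoids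
      · rw [innerClass_shadow, ← innerClass_clUT_inter_eq, innerClass_clIO_union]
        exact shadow_clUT_inter_clOI_union hk (innerClass_mem_ideals_clXI.2 h) h1
    · exact ⟨inter_mem_clonoids clUT_mem_clonoids clR00_mem_clonoids,
        hst _ (hltR _ hlt), shadow_clUT_inter_clR00 hk h h1⟩
  -- an ideal closed under `R`-closures contains neither the identity nor the negation
  · have hRX : Θ ∈ ideals (MinMinC clR) k → idFun ∉ Θ := fun h h' =>
      absurd (apply_const_of_mem_ideals_clR hk h h1 h').2 (by decide)
    have hRO : Θ ∈ ideals (MinMinC clR) k → innerNeg idFun ∉ Θ := fun h h' =>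
      absurd (apply_const_of_mem_ideals_clR hk h h1 h').1 (by decide)
    rintro S₀ (⟨h, rfl⟩ | ⟨h, rfl⟩ | ⟨h, rfl⟩) S₁ (⟨h', rfl⟩ | ⟨h', rfl⟩ | ⟨h', rfl⟩) hle
    · rfl
    · exact absurd (hle ⟨subset_clUT (hXI h hne),
        Or.inl (clM01_subset_clOI idFun_mem_clM01)⟩).2 hidO
    · exact absurd (hXI h hne) (hRX h')
    · refine absurd (hle ⟨subset_clUT (hIX h), Or.inl ?_⟩).2 hnotO
      exact ⟨⟨trivial, rfl⟩, trivial, rfl⟩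
    · rfl
    · exact absurd (hIX h) (hRO h')
    · exact absurd (hXI h' hne) (hRX h)
    · exact absurd (hIX h') (hRO h)
    · rfl
  · rintro Ψ hΨ S₀ (⟨h, rfl⟩ | ⟨h, rfl⟩ | ⟨h, rfl⟩) hle
    · exact hltX Ψ (ltFun_mem_of_isLowerCover hk hΨ hlt (hXI h hne)
        (notMem_ltIdeal (Or.inr rfl))) (hle.trans Set.inter_subset_right)
    · exact hltO Ψ (ltFun_mem_of_isLowerCover hk hΨ hlt (hIX h)
        (notMem_ltIdeal (Or.inl rfl))) (isLowerCover_iff.1 hΨ).1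
        (hle.trans Set.inter_subset_right)
    · exact hltR Ψ (ltFun_mem_of_isLowerCover hk hΨ hlt (xorFun_mem hk h hlt)
        xorFun_notMem_ltIdeal) (hle.trans Set.inter_subset_right)

end BoolClonoid

theorem mainTheorem2 (k : ℕ) (hk : 2 ≤ k) (Θ : Set BoolFun) (hΘ : Θ ∈ ideals MinMin k)
    (hall : Θ ≠ atMost k) (hzero : Θ ≠ constZero) (hempty : Θ ≠ ∅) :
    -- (i)
    HasLowerCovers (clonoids clProj (clMU01 k)) (clUT k Θ)
      ({L | ∃ Ψ, IsLowerCover (ideals MinMin k) Ψ Θ ∧ L = clUT k Ψ} ∪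
        {L | Θ ∈ ideals (MinMinC clXI) k ∧ L = clUT k Θ ∩ (clOI ∪ constZero)} ∪
        {L | Θ ∈ ideals (MinMinC clIX) k ∧ L = clUT k Θ ∩ (clIO ∪ constZero)} ∪
        {L | Θ ∈ ideals (MinMinC clR) k ∧ L = clUT k Θ ∩ clR00}) ∧
    -- (ii)
    (Θ ∈ ideals (MinMinC clXI) k →
      HasLowerCovers (clonoids clProj (clMU01 k)) (clUT k Θ ∩ (clOI ∪ constZero))
        ({L | ∃ Ψ, Ψ.Nonempty ∧ IsLowerCover (ideals (MinMinC clXI) k) Ψ Θ ∧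
            L = clUT k Ψ ∩ (clOI ∪ constZero)} ∪
          {clUT k Θ ∩ clOI} ∪
          {L | Θ ∈ ideals (MinMinC clM) k ∧ L = clUT k Θ ∩ clM0}) ∧
      HasLowerCovers (clonoids clProj (clMU01 k)) (clUT k Θ ∩ clOI)
        ({L | ∃ Ψ, Ψ.Nonempty ∧ IsLowerCover (ideals (MinMinC clXI) k) Ψ Θ ∧
            L = clUT k Ψ ∩ clOI} ∪
          {L | Θ ∈ ideals (MinMinC clM) k ∧ L = clUT k Θ ∩ clM01})) ∧
    -- (iii)
    (Θ ∈ ideals (MinMinC clIX) k →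
      HasLowerCovers (clonoids clProj (clMU01 k)) (clUT k Θ ∩ (clIO ∪ constZero))
        ({L | ∃ Ψ, Ψ.Nonempty ∧ IsLowerCover (ideals (MinMinC clIX) k) Ψ Θ ∧
            L = clUT k Ψ ∩ (clIO ∪ constZero)} ∪
          {clUT k Θ ∩ clIO} ∪
          {L | Θ ∈ ideals (MinMinC (negClass clM)) k ∧ L = clUT k Θ ∩ negClass clM1}) ∧
      HasLowerCovers (clonoids clProj (clMU01 k)) (clUT k Θ ∩ clIO)
        ({L | ∃ Ψ, Ψ.Nonempty ∧ IsLowerCover (ideals (MinMinC clIX) k) Ψ Θ ∧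
            L = clUT k Ψ ∩ clIO} ∪
          {L | Θ ∈ ideals (MinMinC (negClass clM)) k ∧ L = clUT k Θ ∩ negClass clM01})) ∧
    -- (iv)
    (Θ ∈ ideals (MinMinC clM) k →
      HasLowerCovers (clonoids clProj (clMU01 k)) (clUT k Θ ∩ clM0)
        ({L | ∃ Ψ, IsLowerCover (ideals (MinMinC clM) k) Ψ Θ ∧ L = clUT k Ψ ∩ clM0} ∪
          {clUT k Θ ∩ clM01}) ∧
      HasLowerCovers (clonoids clProj (clMU01 k)) (clUT k Θ ∩ clM01)
        {L | ∃ Ψ, IsLowerCover (ideals (MinMinC clM) k) Ψ Θ ∧ L = clUT k Ψ ∩ clM01}) ∧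
    -- (v)
    (Θ ∈ ideals (MinMinC (negClass clM)) k →
      HasLowerCovers (clonoids clProj (clMU01 k)) (clUT k Θ ∩ negClass clM1)
        ({L | ∃ Ψ, IsLowerCover (ideals (MinMinC (negClass clM)) k) Ψ Θ ∧
            L = clUT k Ψ ∩ negClass clM1} ∪
          {clUT k Θ ∩ negClass clM01}) ∧
      HasLowerCovers (clonoids clProj (clMU01 k)) (clUT k Θ ∩ negClass clM01)
        {L | ∃ Ψ, IsLowerCover (ideals (MinMinC (negClass clM)) k) Ψ Θ ∧
          L = clUT k Ψ ∩ negClass clM01}) ∧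
    -- (vi)
    (Θ ∈ ideals (MinMinC clR) k →
      HasLowerCovers (clonoids clProj (clMU01 k)) (clUT k Θ ∩ clR00)
        {L | ∃ Ψ, IsLowerCover (ideals (MinMinC clR) k) Ψ Θ ∧ L = clUT k Ψ ∩ clR00}) := by
  have hne : Θ.Nonempty := Set.nonempty_iff_ne_empty.2 hempty
  have h1 : oneFun ∉ Θ := fun h => hall (eq_atMost_of_oneFun_mem hΘ h)
  exact ⟨hasLowerCovers_clUT hk hΘ h1 hne hzero,
    fun h => ⟨hasLowerCovers_clOI_union hk h h1 hne, hasLowerCovers_clOI hk h h1 hne⟩,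
    fun h => ⟨hasLowerCovers_clIO_union hk h h1 hne, hasLowerCovers_clIO hk h h1 hne⟩,
    fun h => ⟨hasLowerCovers_clM0 hk h h1 hne hzero, hasLowerCovers_clM01 hk h h1 hne hzero⟩,
    fun h => ⟨hasLowerCovers_negClass_clM1 hk h h1 hne hzero,
      hasLowerCovers_negClass_clM01 hk h h1 hne hzero⟩,
    fun h => hasLowerCovers_clR00 hk h h1⟩
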